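/- **Definitions.** For a string $y$ of length $n$ and a string $x$, let $\mathrm{BegPos}_y(x)=\{i : 1\le i\le n-|x|+1,\ y[i..i+|x|-1]=x\}$ and $\mathrm{EndPos}_y(x)=\{i : |x|\le i\le n,\ y[i-|x|+1..i]=x\}$, and let $[x]_y$ be the set of all strings with the same set $\mathrm{EndPos}_y$ as $x$. For a substring $x$ of $y$ let $\overrightarrow{x}$ be the longest string with the same set $\mathrm{BegPos}_y$ as $x$. * The *suffix tree* $\mathrm{ST}(y)$ has the nodes $V=\{\overrightarrow{x} : x \text{ a substring of } y\}$ and the edges $(x,\beta,x\beta)$ with $x,x\beta\in V$, $\beta\ne\varepsilon$ and $\overrightarrow{xb}=x\beta$, where $b$ is the first character of $\beta$; its *suffix links* are the triples $(ax,a,x)$ with $a$ a character and $x,ax\in V$. Each edge label $\beta$ is stored as a pair $(i,j)$ with $y[i..j]=\beta$. * The *DAWG* of a string $z$ has the nodes $[x]_z$ for the substrings $x$ of $z$ and the edges $([x]_z,b,[xb]_z)$ for the substrings $x,xb$ of $z$ with $b$ a character; its *suffix links* are the triples $([ax]_z,a,[x]_z)$ for the substrings $x,ax$ of $z$ with $a$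 a character and $[ax]_z\ne[x]_z$. It is *edge-sorted* if the out-going edges of each node are stored in increasing order of their labels. **Theorem.** Let $c$ be a constant. Given a string $y$ of length $n\ge 1$ over the integer alphabet $\{1,\dots,n^c\}$ whose last character occurs nowhere else in $y$, together with the suffix tree $\mathrm{ST}(y)$ and its suffix links (with the nodes numbered, and the edges and links listed, in any order), the edge-sorted DAWG of the reversed string of $y$, with its suffix links, can be constructed in $O(n)$ time and $O(n)$ words of space on a word RAM with words of $\Theta(\log n)$ bits (just long enough to hold the characters and the addresses of $O(n)$ memory cells). One program does this for all $c$; the constants in the $O$-bounds depend only on $c$. -/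

import Mathlib

namespace StringIndex

variable {α : Type*}

/-- The substring `y[i..j]`, with positions counted from `1`; it is empty when `i > j`. -/
def factor (y : List α) (i j : ℕ) : List α := (y.take j).drop (i - 1)

/-- The set of all substrings of `y`. -/
def Substr (y : List α) : Set (List α) := {x | ∃ u v, y = u ++ x ++ v}

/-- The beginning positions of the occurrences of `x` in `y`. -/
def BegPos (y x : List α) : Set ℕ :=
  {i | 1 ≤ i ∧ i + x.length ≤ y.length + 1 ∧ factor y i (i + x.length - 1) = x}

/-- The ending positions of the occurrences of `x` in `y`. -/
def EndPos (y x : List α) : Set ℕ :=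
  {i | x.length ≤ i ∧ i ≤ y.length ∧ factor y (i - x.length + 1) i = x}

/-- `z` is the longest string with the same beginning positions in `y` as `x`. -/
def IsLongestBeg (y x z : List α) : Prop :=
  BegPos y z = BegPos y x ∧ ∀ z', BegPos y z' = BegPos y x → z'.length ≤ z.length

/-- Nodes of the suffix tree of `y`. -/
def suffixTreeNodes (y : List α) : Set (List α) :=
  {z | ∃ x ∈ Substr y, IsLongestBeg y x z}

/-- Edges `(x, β, xβ)` of the suffix tree of `y`. -/
def suffixTreeEdges (y : List α) : Set (List α × List α × List α) :=
  {e | ∃ (x : List α) (b : α) (γ : List α), e = (x, b :: γ, x ++ b :: γ) ∧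
    x ∈ suffixTreeNodes y ∧ x ++ b :: γ ∈ suffixTreeNodes y ∧
    IsLongestBeg y (x ++ [b]) (x ++ b :: γ)}

/-- Suffix links `(ax, a, x)` of the suffix tree of `y`. -/
def suffixTreeLinks (y : List α) : Set (List α × α × List α) :=
  {e | ∃ (a : α) (x : List α), e = (a :: x, a, x) ∧
    x ∈ suffixTreeNodes y ∧ a :: x ∈ suffixTreeNodes y}

/-- The class of all strings that have the same ending positions in `y` as `x`. -/
def endClass (y x : List α) : Set (List α) := {z | EndPos y z = EndPos y x}

/-- Nodes of the DAWG of `y`. -/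
def dawgNodes (y : List α) : Set (Set (List α)) := {v | ∃ x ∈ Substr y, v = endClass y x}

/-- Edges of the DAWG of `y`. -/
def dawgEdges (y : List α) : Set (Set (List α) × α × Set (List α)) :=
  {e | ∃ (x : List α) (b : α), e = (endClass y x, b, endClass y (x ++ [b])) ∧
    x ∈ Substr y ∧ x ++ [b] ∈ Substr y}

/-- Suffix links of the DAWG of `y`. -/
def dawgLinks (y : List α) : Set (Set (List α) × α × Set (List α)) :=
  {e | ∃ (a : α) (x : List α), e = (endClass y (a :: x), a, endClass y x) ∧
    x ∈ Substr y ∧ a :: x ∈ Substr y ∧ endClass y (a :: x) ≠ endClass y x}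

/-- The list `l` contains every element of `S` exactly once, and nothing else. -/
def Enumerates {β : Type*} (l : List β) (S : Set β) : Prop := l.Nodup ∧ ∀ x, x ∈ l ↔ x ∈ S

/-- An edge of a stored suffix tree: the numbers of its end nodes, and two positions `i`, `j`
such that its label is `y[i..j]`. -/
structure TreeEdge where
  src : ℕ
  i : ℕ
  j : ℕ
  dst : ℕ

/-- A suffix link of a stored suffix tree, between numbered nodes. -/
structure TreeLink where
  src : ℕ
  label : ℕ
  dst : ℕ

/-- A suffix tree with suffix links, as a data structure whose nodes are `0, …, size - 1`. -/
structure TreeData where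
  size : ℕ
  root : ℕ
  edges : List TreeEdge
  links : List TreeLink

/-- `T` is the suffix tree of `y` with its suffix links, where node number `v` stands for the
string `node v`. The numbering of the nodes and the orders of the lists are arbitrary. -/
structure TreeData.Represents (T : TreeData) (y : List ℕ) (node : ℕ → List ℕ) : Prop where
  nodes : Set.BijOn node (Set.Iio T.size) (suffixTreeNodes y)
  root_lt : T.root < T.size
  root_eq : node T.root = []
  edges_range : ∀ e ∈ T.edges, e.src < T.size ∧ e.dst < T.size ∧
    1 ≤ e.i ∧ e.i ≤ e.j ∧ e.j ≤ y.length
  edges : Enumerates (T.edges.map fun e => (node e.src, factor y e.i e.j, node e.dst))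
    (suffixTreeEdges y)
  links_range : ∀ e ∈ T.links, e.src < T.size ∧ e.dst < T.size
  links : Enumerates (T.links.map fun e => (node e.src, e.label, node e.dst))
    (suffixTreeLinks y)

/-- The words of the input: five numbers, the string, the edges, the suffix links. -/
def TreeData.words (T : TreeData) (y : List ℕ) : List ℕ :=
  [y.length, T.size, T.root, T.edges.length, T.links.length] ++ y ++
    T.edges.flatMap (fun e => [e.src, e.i, e.j, e.dst]) ++
    T.links.flatMap (fun e => [e.src, e.label, e.dst])

/-- A DAWG with suffix links, as a data structure whose nodes are `0, …, size - 1`: `adj v` is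
the list of the pairs (label, target) of the out-going edges of `v`, and `link v` is the pair
(label, target) of the suffix link of `v`, if there is one. -/
structure DawgData where
  size : ℕ
  source : ℕ
  adj : ℕ → List (ℕ × ℕ)
  link : ℕ → Option (ℕ × ℕ)

/-- `D` is the edge-sorted DAWG of `y` with its suffix links, where node number `v` stands for the
class `node v`. -/
structure DawgData.Represents (D : DawgData) (y : List ℕ) (node : ℕ → Set (List ℕ)) : Prop where
  nodes : Set.BijOn node (Set.Iio D.size) (dawgNodes y)
  source_lt : D.source < D.size
  source_eq : node D.source = endClass y []
  adj_range : ∀ v < D.size, ∀ e ∈ D.adj v, e.2 < D.size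
  adj : ∀ v < D.size, ∀ u < D.size, ∀ a,
    (a, u) ∈ D.adj v ↔ (node v, a, node u) ∈ dawgEdges y
  sorted : ∀ v < D.size, (D.adj v).Pairwise fun e f => e.1 < f.1
  link_range : ∀ v < D.size, ∀ e, D.link v = some e → e.2 < D.size
  link : ∀ v < D.size, ∀ u < D.size, ∀ a,
    D.link v = some (a, u) ↔ (node v, a, node u) ∈ dawgLinks y

/-- The number of edges that leave the nodes `0, …, v - 1`. -/
def DawgData.offset (D : DawgData) (v : ℕ) : ℕ := ∑ u ∈ Finset.range v, (D.adj u).length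

/-- The words of the output: the number of nodes and the source; for each node the offset of its
block of edges (and the total number of edges); the blocks of the edges, node by node, each in its
order; and for each node three words for its suffix link, the first of which tells whether there
is one. -/
def DawgData.words (D : DawgData) : List ℕ :=
  [D.size, D.source] ++ (List.range (D.size + 1)).map D.offset ++
    (List.range D.size).flatMap (fun v => (D.adj v).flatMap fun e => [e.1, e.2]) ++
    (List.range D.size).flatMap (fun v => match D.link v with
      | none => [0, 0, 0]
      | some e => [1, e.1, e.2])

end StringIndex

namespace WordRAM

/-- The two-operand instructions of a word RAM. -/
inductive BinOp
  | add | sub | mul | div | mod | and | or | xor | shl | shr | lt | eq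

/-- The result of a two-operand instruction on `w`-bit words, a `w`-bit word. -/
def BinOp.eval (w : ℕ) (op : BinOp) (a b : ℕ) : ℕ :=
  (match op with
    | .add => a + b
    | .sub => a + (2 ^ w - b)
    | .mul => a * b
    | .div => a / b
    | .mod => a % b
    | .and => a &&& b
    | .or => a ||| b
    | .xor => a ^^^ b
    | .shl => a <<< b
    | .shr => a >>> b
    | .lt => if a < b then 1 else 0
    | .eq => if a = b then 1 else 0) % 2 ^ w

/-- Programs of a word RAM. A register is named by a natural number; a program is a finite
expression, so it uses only constantly many registers. -/
inductive Prog
  | skip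
  /-- `reg r := v` -/
  | const (r v : ℕ)
  /-- `reg r := op (reg a) (reg b)` -/
  | bin (op : BinOp) (r a b : ℕ)
  /-- `reg r := mem (reg a)` -/
  | load (r a : ℕ)
  /-- `mem (reg a) := reg r` -/
  | store (a r : ℕ)
  | seq (p q : Prog)
  /-- if `reg r ≠ 0` then `p` else `q` -/
  | cond (r : ℕ) (p q : Prog)
  /-- while `reg r ≠ 0` do `p` -/
  | loop (r : ℕ) (p : Prog)

/-- The contents of the registers and of the memory. -/
structure State where
  reg : ℕ → ℕ
  mem : ℕ → ℕ

/-- Every register and every memory cell holds a `w`-bit word. -/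
def State.Fits (w : ℕ) (s : State) : Prop := (∀ r, s.reg r < 2 ^ w) ∧ ∀ k, s.mem k < 2 ^ w

/-- The words of the list `l` stand in consecutive memory cells, the first one at address `k`. -/
def State.Holds (s : State) (k : ℕ) (l : List ℕ) : Prop :=
  ∀ (i : ℕ) (h : i < l.length), s.mem (k + i) = l[i]

/-- `Exec w S p s t s'`: on a machine with `w`-bit words and `S` words of memory (addresses
`0, …, S - 1`), the program `p` started in state `s` halts in state `s'` after `t` steps. Every
instruction and every test is one step; a program that accesses a cell outside of the memory
does not halt. -/
inductive Exec (w S : ℕ) : Prog → State → ℕ → State → Prop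
  | skip (s : State) : Exec w S .skip s 1 s
  | const (r v : ℕ) (s : State) :
      Exec w S (.const r v) s 1 { s with reg := Function.update s.reg r (v % 2 ^ w) }
  | bin (op : BinOp) (r a b : ℕ) (s : State) :
      Exec w S (.bin op r a b) s 1
        { s with reg := Function.update s.reg r (op.eval w (s.reg a) (s.reg b)) }
  | load (r a : ℕ) (s : State) (h : s.reg a < S) :
      Exec w S (.load r a) s 1 { s with reg := Function.update s.reg r (s.mem (s.reg a)) }
  | store (a r : ℕ) (s : State) (h : s.reg a < S) :
      Exec w S (.store a r) s 1 { s with mem := Function.update s.mem (s.reg a) (s.reg r) }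
  | seq {p q : Prog} {s s₁ s₂ : State} {t₁ t₂ : ℕ} :
      Exec w S p s t₁ s₁ → Exec w S q s₁ t₂ s₂ → Exec w S (.seq p q) s (t₁ + t₂) s₂
  | condTrue {r : ℕ} {p q : Prog} {s s₁ : State} {t : ℕ} :
      s.reg r ≠ 0 → Exec w S p s t s₁ → Exec w S (.cond r p q) s (t + 1) s₁
  | condFalse {r : ℕ} {p q : Prog} {s s₁ : State} {t : ℕ} :
      s.reg r = 0 → Exec w S q s t s₁ → Exec w S (.cond r p q) s (t + 1) s₁
  | loopStop {r : ℕ} {p : Prog} {s : State} :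
      s.reg r = 0 → Exec w S (.loop r p) s 1 s
  | loopStep {r : ℕ} {p : Prog} {s s₁ s₂ : State} {t₁ t₂ : ℕ} :
      s.reg r ≠ 0 → Exec w S p s t₁ s₁ → Exec w S (.loop r p) s₁ t₂ s₂ →
      Exec w S (.loop r p) s (t₁ + t₂ + 1) s₂

end WordRAM

/-!
Write `n` for the length of `y`. Reversal turns end positions into beginning positions, so the
classes `[x]` of the reversed string correspond to the nodes of the suffix tree of `y`, each class
to its longest string read backwards; `Represents.dawg_bijOn` lets the DAWG keep the numbers of the
tree nodes. The suffix links of the DAWG are the tree edges read upwards, labelled by their first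
characters (`Represents.mem_dawgLinks`). The DAWG has an edge with the label `b` from `V` to `v` iff
`bV` is a substring with the same beginning positions as `v` (`Represents.mem_dawgEdges`).

These edges are found by walks. Let `(v, b, u)` be a suffix link of the tree, so `v = bu`, and let
`p` be the parent of `v`. The sources of the edges into `v` are the nodes that are prefixes of `u`
and, after `b` has been put in front, longer than `p`. They lie on the way from `u` towards the
root, before the node that the suffix link of `p` leads to; if `p` is the root, they are all nodes
up to and including the root (`Represents.exists_walk`). A walk costs as much as it finds, so the
time is linear in the number of DAWG edges. That number is at most `3n + 3`
(`weiner_links_length_le`): the edges with `bV` a node are no more than the nodes, of which there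
are at most `2n + 2` (`exists_node_numbering`), and each of the others is determined by any end
position of `bV`, where `V` is the longest suffix that is a node.

Each found edge becomes a record, and the records are sorted by label and then, stably, by source.
The sort by label is a radix sort with the number of nodes as base; as this number exceeds `n`,
there are at most `c + 1` digits, and the program sees when they run out (`wp_sortLabels`). One
bucket sort serves for all digits and for the sources (`wp_bucketSort`). Its buckets are linked
lists, and it also yields the offsets of the blocks of edges.

The program is written for an abstract machine with variables and sixteen arrays of length `64n`,
over natural numbers, in terms of expressions, assignments and loops that stand for programs of the
word RAM. A weakest precondition `WP` carries the correctness proof; its rules hide words and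
addresses, and a clock in the abstract state bounds the number of steps.
-/


/-! ### An abstract machine on top of the word RAM -/

namespace WordRAM

/-- A state of the abstract machine: a clock, and variables and arrays named by numbers. -/
structure St where
  clk : ℕ
  var : ℕ → ℕ
  arr : ℕ → ℕ → ℕ

/-- The parameters of the machine that runs an abstract program: the word length, the memory size,
and the common length `blk` of the sixteen arrays, at least `16`. -/
structure Mach where
  w : ℕ
  size : ℕ
  blk : ℕ
  le_blk : 16 ≤ blk
  blk_le : 16 * blk ≤ size
  size_le : size ≤ 2 ^ w

/-- The abstract state `σ` is stored in the state `s`: register `0` holds the array length `blk`,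
the even registers from `2` on hold the variables, and array `a` starts at the address `a * blk`.
The odd registers are left for intermediate results. -/
structure Rel (m : Mach) (σ : St) (s : State) : Prop where
  fits : s.Fits m.w
  blk : s.reg 0 = m.blk
  vars : ∀ x, s.reg (2 * x + 2) = σ.var x
  arrs : ∀ a < 16, ∀ i < m.blk, s.mem (a * m.blk + i) = σ.arr a i

/-- The operations that occur in expressions. -/
inductive Op
  | add | sub | mul | div | mod | lt | eq

/-- The machine instruction for the operation. -/
def Op.toBin : Op → BinOp
  | .add => .add
  | .sub => .sub
  | .mul => .mul
  | .div => .div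
  | .mod => .mod
  | .lt => .lt
  | .eq => .eq

/-- The result of the operation on natural numbers, without overflow. -/
@[simp] def Op.val : Op → ℕ → ℕ → ℕ
  | .add, a, b => a + b
  | .sub, a, b => a - b
  | .mul, a, b => a * b
  | .div, a, b => a / b
  | .mod, a, b => a % b
  | .lt, a, b => if a < b then 1 else 0
  | .eq, a, b => if a = b then 1 else 0

/-- A condition under which the operation gives the same result on machine words as on natural
numbers; `bd` is a lower bound for the number of machine words. -/
@[simp] def Op.Safe (bd : ℕ) : Op → ℕ → ℕ → Prop
  | .add, a, b => a + b < bd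
  | .sub, a, b => b ≤ a
  | .mul, a, b => a * b < bd
  | _, _, _ => True

/-- Expressions over variables and array entries. -/
inductive Expr
  | lit (v : ℕ)
  | var (x : ℕ)
  | bin (op : Op) (e f : Expr)
  | get (a : ℕ) (e : Expr)

/-- The value of the expression as a natural number. -/
@[simp] def Expr.eval (σ : St) : Expr → ℕ
  | .lit v => v
  | .var x => σ.var x
  | .bin op e f => op.val (e.eval σ) (f.eval σ)
  | .get a e => σ.arr a (e.eval σ)

/-- The evaluation of the expression meets no overflow and no index out of range. -/
@[simp] def Expr.Ok (blk : ℕ) (σ : St) : Expr → Prop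
  | .lit v => v < 16 * blk
  | .var _ => True
  | .bin op e f => e.Ok blk σ ∧ f.Ok blk σ ∧ op.Safe (16 * blk) (e.eval σ) (f.eval σ)
  | .get a e => a < 16 ∧ e.Ok blk σ ∧ e.eval σ < blk

/-- The number of instructions that evaluate the expression. -/
@[simp] def Expr.cost : Expr → ℕ
  | .lit _ => 1
  | .var _ => 1
  | .bin _ e f => e.cost + f.cost + 1
  | .get _ e => e.cost + 4

/-- A program that turns the index in the `k`-th odd register into the address of that entry of
array `a`, with the `l`-th odd register as scratch space. -/
def address (a k l : ℕ) : Prog :=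
  .seq (.const (2 * l + 1) a) (.seq (.bin .mul (2 * l + 1) (2 * l + 1) 0)
    (.bin .add (2 * k + 1) (2 * k + 1) (2 * l + 1)))

/-- A program that leaves the value of the expression in the `k`-th odd register, and that changes
no even and no lower register. -/
def Expr.compile : Expr → ℕ → Prog
  | .lit v, k => .const (2 * k + 1) v
  | .var x, k => .bin .or (2 * k + 1) (2 * x + 2) (2 * x + 2)
  | .bin op e f, k => .seq (e.compile k) (.seq (f.compile (k + 1))
      (.bin op.toBin (2 * k + 1) (2 * k + 1) (2 * (k + 1) + 1)))
  | .get a e, k => .seq (e.compile k) (.seq (address a k (k + 1)) (.load (2 * k + 1) (2 * k + 1)))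

/-- Variable `x` is set to the value of `e`. -/
def assign (x : ℕ) (e : Expr) : Prog := .seq (e.compile 0) (.bin .or (2 * x + 2) 1 1)

/-- The entry `i` of array `a` is set to the value of `e`. -/
def put (a : ℕ) (i e : Expr) : Prog :=
  .seq (i.compile 0) (.seq (e.compile 1) (.seq (address a 0 2) (.store 1 3)))

/-- While the value of `e` is not `0`, run `p`. -/
def while_ (e : Expr) (p : Prog) : Prog := .seq (e.compile 0) (.loop 1 (.seq p (e.compile 0)))

/-- For the values `0, 1, …` of variable `x` as long as they are below `b`, run `p`. -/
def for_ (x : ℕ) (b : Expr) (p : Prog) : Prog :=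
  .seq (assign x (.lit 0))
    (while_ (.bin .lt (.var x) b) (.seq p (assign x (.bin .add (.var x) (.lit 1)))))

/-! ### Correctness of compiled expressions -/

theorem Op.eval_eq {w bd a b : ℕ} (op : Op) (hbd : bd ≤ 2 ^ w) (h1 : 1 < 2 ^ w) (ha : a < 2 ^ w)
    (hs : op.Safe bd a b) : op.toBin.eval w a b = op.val a b := by
  cases op <;> simp only [Op.toBin, BinOp.eval, Op.val, Op.Safe] at *
  · exact Nat.mod_eq_of_lt (by omega)
  · rw [show a + (2 ^ w - b) = a - b + 2 ^ w by omega, Nat.add_mod_right]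
    exact Nat.mod_eq_of_lt (by omega)
  · exact Nat.mod_eq_of_lt (by omega)
  · exact Nat.mod_eq_of_lt ((Nat.div_le_self a b).trans_lt ha)
  · exact Nat.mod_eq_of_lt ((Nat.mod_le a b).trans_lt ha)
  · split_ifs <;> exact Nat.mod_eq_of_lt (by omega)
  · split_ifs <;> exact Nat.mod_eq_of_lt (by omega)

theorem BinOp.eval_lt (w : ℕ) (op : BinOp) (a b : ℕ) : op.eval w a b < 2 ^ w :=
  Nat.mod_lt _ (by positivity)

theorem State.Fits.update_reg {w : ℕ} {s : State} (h : s.Fits w) (r : ℕ) {v : ℕ} (hv : v < 2 ^ w) :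
    State.Fits w { s with reg := Function.update s.reg r v } := by
  refine ⟨fun r' => ?_, h.2⟩
  rcases eq_or_ne r' r with rfl | hr
  · simpa using hv
  · simpa [Function.update_of_ne hr] using h.1 r'

theorem State.Fits.update_mem {w : ℕ} {s : State} (h : s.Fits w) (k : ℕ) {v : ℕ} (hv : v < 2 ^ w) :
    State.Fits w { s with mem := Function.update s.mem k v } := by
  refine ⟨h.1, fun k' => ?_⟩
  rcases eq_or_ne k' k with rfl | hk
  · simpa using hv
  · simpa [Function.update_of_ne hk] using h.2 k'

/-- The state `s'` differs from `s` at most in the odd registers from the `k`-th on. -/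
structure Keeps (w k : ℕ) (s s' : State) : Prop where
  fits : s'.Fits w
  mem : s'.mem = s.mem
  reg : ∀ r, r % 2 = 0 ∨ r < 2 * k + 1 → s'.reg r = s.reg r

theorem Keeps.trans {w k l : ℕ} {s s' s'' : State} (h : Keeps w k s s') (h' : Keeps w l s' s'')
    (hkl : k ≤ l) : Keeps w k s s'' :=
  ⟨h'.fits, h'.mem.trans h.mem, fun r hr => by
    rw [h'.reg r (by omega), h.reg r hr]⟩

theorem Keeps.rel {m : Mach} {σ : St} {k : ℕ} {s s' : State} (h : Keeps m.w k s s')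
    (hs : Rel m σ s) : Rel m σ s' :=
  ⟨h.fits, by rw [h.reg 0 (by omega), hs.blk], fun x => by rw [h.reg _ (by omega), hs.vars],
    fun a ha i hi => by rw [h.mem, hs.arrs a ha i hi]⟩

theorem Keeps.update {w k : ℕ} {s : State} (h : s.Fits w) {v : ℕ} (hv : v < 2 ^ w) :
    Keeps w k s { s with reg := Function.update s.reg (2 * k + 1) v } :=
  ⟨h.update_reg _ hv, rfl, fun r hr => Function.update_of_ne (by omega) _ _⟩

theorem Mach.block_lt (m : Mach) {a i : ℕ} (ha : a < 16) (hi : i < m.blk) :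
    a * m.blk + i < 16 * m.blk := by
  have : a * m.blk ≤ 15 * m.blk := Nat.mul_le_mul_right _ (by omega)
  omega

theorem Mach.two_le (m : Mach) : 1 < 2 ^ m.w := by
  have := m.le_blk; have := m.blk_le; have := m.size_le; omega

theorem exec_address {m : Mach} {σ : St} {s : State} (hs : Rel m σ s) {a k l i : ℕ} (ha : a < 16)
    (hi : i < m.blk) (hkl : k < l) (hk : s.reg (2 * k + 1) = i) :
    ∃ s', Exec m.w m.size (address a k l) s 3 s' ∧ s'.reg (2 * k + 1) = a * m.blk + i ∧
      s'.Fits m.w ∧ s'.mem = s.mem ∧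
      ∀ r, r ≠ 2 * k + 1 → r ≠ 2 * l + 1 → s'.reg r = s.reg r := by
  have h1 := m.block_lt ha hi
  have h2 := m.blk_le
  have h3 := m.size_le
  have h4 := m.le_blk
  have hlk : 2 * k + 1 ≠ 2 * l + 1 := by omega
  have e := (Exec.const (w := m.w) (S := m.size) (2 * l + 1) a s).seq
    ((Exec.bin .mul (2 * l + 1) (2 * l + 1) 0 _).seq
      (Exec.bin .add (2 * k + 1) (2 * k + 1) (2 * l + 1) _))
  refine ⟨_, e, ?_, ?_, rfl, ?_⟩
  · have ha' : a % 2 ^ m.w = a := Nat.mod_eq_of_lt (by omega)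
    simp [BinOp.eval, Function.update_of_ne hlk, hk, hs.blk, ha']
    rw [add_comm]
    exact Nat.mod_eq_of_lt (by omega)
  · exact ((hs.fits.update_reg _ (Nat.mod_lt _ (by positivity))).update_reg _
      (BinOp.eval_lt _ _ _ _)).update_reg _ (BinOp.eval_lt _ _ _ _)
  · intro r hr hr'
    simp [Function.update_of_ne hr, Function.update_of_ne hr']

theorem Expr.exec_compile {m : Mach} {σ : St} (e : Expr) :
    ∀ (k : ℕ) (s : State), Rel m σ s → e.Ok m.blk σ →
      ∃ s', Exec m.w m.size (e.compile k) s e.cost s' ∧ Keeps m.w k s s' ∧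
        s'.reg (2 * k + 1) = e.eval σ := by
  have hb := m.blk_le
  have hb' := m.size_le
  have h1 := m.two_le
  induction e with
  | lit v =>
    intro k s hs hok
    have hv : v % 2 ^ m.w = v := Nat.mod_eq_of_lt (by simp at hok; omega)
    exact ⟨_, Exec.const _ _ _, Keeps.update hs.fits (Nat.mod_lt _ (by positivity)), by simp [hv]⟩
  | var x =>
    intro k s hs hok
    refine ⟨_, Exec.bin _ _ _ _ _, Keeps.update hs.fits (BinOp.eval_lt _ _ _ _), ?_⟩
    have hf := hs.fits.1 (2 * x + 2)
    rw [hs.vars] at hf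
    simp [BinOp.eval, hs.vars, Nat.mod_eq_of_lt hf]
  | bin op e f ihe ihf =>
    intro k s hs hok
    obtain ⟨s1, x1, k1, v1⟩ := ihe k s hs hok.1
    obtain ⟨s2, x2, k2, v2⟩ := ihf (k + 1) s1 (k1.rel hs) hok.2.1
    have v1' : s2.reg (2 * k + 1) = e.eval σ := by rw [k2.reg _ (by omega), v1]
    refine ⟨_, (x1.seq (x2.seq (Exec.bin _ _ _ _ _))), (k1.trans k2 (by omega)).trans
      (Keeps.update k2.fits (BinOp.eval_lt _ _ _ _)) le_rfl, ?_⟩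
    have hlt : e.eval σ < 2 ^ m.w := v1' ▸ k2.fits.1 _
    simp only [Function.update_self, v1', v2, Expr.eval]
    exact op.eval_eq (by omega) h1 hlt hok.2.2
  | get a e ih =>
    intro k s hs hok
    obtain ⟨ha, hoe, hlt⟩ := hok
    obtain ⟨s1, x1, k1, v1⟩ := ih k s hs hoe
    obtain ⟨s2, x2, v2, f2, m2, r2⟩ := exec_address (k1.rel hs) (l := k + 1) ha hlt (by omega) v1
    have hin := m.block_lt ha hlt
    have x3 := Exec.load (w := m.w) (S := m.size) (2 * k + 1) (2 * k + 1) s2 (by omega)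
    have k2 : Keeps m.w k s1 s2 := ⟨f2, m2, fun r hr => r2 r (by omega) (by omega)⟩
    refine ⟨_, x1.seq (x2.seq x3), (k1.trans k2 le_rfl).trans
      (Keeps.update k2.fits (f2.2 _)) le_rfl, ?_⟩
    simp [v2, m2, k1.mem, hs.arrs a ha _ hlt]

/-! ### Weakest preconditions -/

/-- `p` run from the abstract state `σ` halts in some state that satisfies `Q`, and takes at most
the time by which the clock goes on. -/
def WP (m : Mach) (p : Prog) (σ : St) (Q : St → Prop) : Prop :=
  ∀ s, Rel m σ s → ∃ t s' σ', Exec m.w m.size p s t s' ∧ σ.clk + t ≤ σ'.clk ∧ Rel m σ' s' ∧ Q σ'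

/-- The state after `c` steps that change neither variables nor arrays. -/
def St.tick (σ : St) (c : ℕ) : St := { σ with clk := σ.clk + c }

/-- Variable `x` is set to `v` in `c` steps. -/
def St.setVar (σ : St) (x v c : ℕ) : St :=
  { σ with clk := σ.clk + c, var := Function.update σ.var x v }

/-- Entry `i` of array `a` is set to `v` in `c` steps. -/
def St.setArr (σ : St) (a i v c : ℕ) : St :=
  { σ with clk := σ.clk + c, arr := Function.update σ.arr a (Function.update (σ.arr a) i v) }

@[simp] theorem St.tick_clk (σ : St) (c : ℕ) : (σ.tick c).clk = σ.clk + c := rfl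
@[simp] theorem St.tick_var (σ : St) (c : ℕ) : (σ.tick c).var = σ.var := rfl
@[simp] theorem St.tick_arr (σ : St) (c : ℕ) : (σ.tick c).arr = σ.arr := rfl
@[simp] theorem St.setVar_clk (σ : St) (x v c : ℕ) : (σ.setVar x v c).clk = σ.clk + c := rfl
@[simp] theorem St.setVar_arr (σ : St) (x v c : ℕ) : (σ.setVar x v c).arr = σ.arr := rfl
@[simp] theorem St.setArr_clk (σ : St) (a i v c : ℕ) : (σ.setArr a i v c).clk = σ.clk + c := rfl
@[simp] theorem St.setArr_var (σ : St) (a i v c : ℕ) : (σ.setArr a i v c).var = σ.var := rfl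
theorem St.setVar_var (σ : St) (x v c y : ℕ) :
    (σ.setVar x v c).var y = if y = x then v else σ.var y := by
  simp [St.setVar, Function.update_apply]
theorem St.setArr_arr (σ : St) (a i v c b : ℕ) :
    (σ.setArr a i v c).arr b = if b = a then Function.update (σ.arr a) i v else σ.arr b := by
  simp [St.setArr, Function.update_apply]

theorem WP.mono {m : Mach} {p : Prog} {σ : St} {Q R : St → Prop} (h : WP m p σ Q)
    (hQR : ∀ σ', Q σ' → R σ') : WP m p σ R := fun s hs => by
  obtain ⟨t, s', σ', h1, h2, h3, h4⟩ := h s hs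
  exact ⟨t, s', σ', h1, h2, h3, hQR _ h4⟩

theorem WP.seq {m : Mach} {p q : Prog} {σ : St} {Q : St → Prop}
    (h : WP m p σ fun σ' => WP m q σ' Q) : WP m (.seq p q) σ Q := fun s hs => by
  obtain ⟨t, s', σ', h1, h2, h3, h4⟩ := h s hs
  obtain ⟨t', s'', σ'', h1', h2', h3', h4'⟩ := h4 s' h3
  exact ⟨_, s'', σ'', h1.seq h1', by omega, h3', h4'⟩

theorem WP.assign {m : Mach} {x : ℕ} {e : Expr} {σ : St} {Q : St → Prop} (hok : e.Ok m.blk σ)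
    (hQ : Q (σ.setVar x (e.eval σ) (e.cost + 1))) : WP m (assign x e) σ Q := fun s hs => by
  obtain ⟨s1, x1, k1, v1⟩ := e.exec_compile 0 s hs hok
  have hs1 := k1.rel hs
  have hv : BinOp.or.eval m.w (s1.reg 1) (s1.reg 1) = e.eval σ := by
    have := k1.fits.1 1
    simp only [mul_zero, zero_add] at v1
    simp only [BinOp.eval, Nat.or_self]
    rw [v1] at this ⊢
    exact Nat.mod_eq_of_lt this
  refine ⟨_, _, _, x1.seq (Exec.bin _ _ _ _ _), le_rfl, ⟨?_, ?_, ?_, ?_⟩, hQ⟩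
  · exact k1.fits.update_reg _ (BinOp.eval_lt _ _ _ _)
  · simpa using hs1.blk
  · intro z
    simp only [hv, St.setVar, Function.update_apply, hs1.vars]
    congr 1
    simp
  · exact hs1.arrs

theorem WP.put {m : Mach} {a : ℕ} {i e : Expr} {σ : St} {Q : St → Prop}
    (ha : a < 16) (hi : i.Ok m.blk σ) (hlt : i.eval σ < m.blk) (he : e.Ok m.blk σ)
    (hQ : Q (σ.setArr a (i.eval σ) (e.eval σ) (i.cost + e.cost + 4))) :
    WP m (put a i e) σ Q := fun s hs => by
  obtain ⟨s1, x1, k1, v1⟩ := i.exec_compile 0 s hs hi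
  obtain ⟨s2, x2, k2, v2⟩ := e.exec_compile 1 s1 (k1.rel hs) he
  have v1' : s2.reg (2 * 0 + 1) = i.eval σ := by rw [k2.reg _ (by omega), v1]
  have hs2 := k2.rel (k1.rel hs)
  obtain ⟨s3, x3, v3, f3, m3, r3⟩ := exec_address hs2 (l := 2) ha hlt (by omega) v1'
  have hin := m.block_lt ha hlt
  have hb := m.blk_le
  simp only [mul_zero, zero_add] at v3
  have x4 := Exec.store (w := m.w) (S := m.size) 1 3 s3 (by omega)
  refine ⟨_, _, _, x1.seq (x2.seq (x3.seq x4)), ?_, ⟨?_, ?_, ?_, ?_⟩, hQ⟩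
  · simp only [St.setArr_clk]; omega
  · exact f3.update_mem _ (f3.1 _)
  · exact (r3 0 (by omega) (by omega)).trans hs2.blk
  · intro x
    exact (r3 _ (by omega) (by omega)).trans (hs2.vars x)
  · intro b hb j hj
    have h3 : s3.reg 3 = e.eval σ := by rw [r3 3 (by omega) (by omega)]; exact v2
    simp only [v3, m3, h3, Function.update_apply, St.setArr_arr]
    by_cases hba : b = a
    · subst hba
      by_cases hji : j = i.eval σ
      · simp [hji]
      · simp [hji, hs2.arrs b hb j hj]
    · have : b * m.blk + j ≠ a * m.blk + i.eval σ := by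
        rcases lt_or_gt_of_ne hba with h | h
        · have : (b + 1) * m.blk ≤ a * m.blk := Nat.mul_le_mul_right _ h
          rw [add_mul] at this; omega
        · have : (a + 1) * m.blk ≤ b * m.blk := Nat.mul_le_mul_right _ h
          rw [add_mul] at this; omega
      simp [this, hba, hs2.arrs b hb j hj]

/-- The rule for loops whose invariant is indexed by a number that decreases in each round. -/
theorem WP.while_of_index {m : Mach} {e : Expr} {p : Prog} {Q : St → Prop} (I : ℕ → St → Prop)
    (hok : ∀ k σ, I k σ → e.Ok m.blk σ)
    (hstep : ∀ k σ, I k σ → e.eval σ ≠ 0 →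
      WP m p (σ.tick (e.cost + 1)) fun σ' => ∃ k' < k, I k' σ')
    (hend : ∀ k σ, I k σ → e.eval σ = 0 → Q (σ.tick (e.cost + 1))) {k : ℕ} {σ : St}
    (h0 : I k σ) : WP m (while_ e p) σ Q := by
  -- the loop proper starts after `e` has been evaluated, so the clock is `e.cost` ahead
  have key : ∀ k (σ : St) (s : State), I k σ → Rel m σ s → s.reg 1 = e.eval σ →
      ∃ t s' σ', Exec m.w m.size (.loop 1 (.seq p (e.compile 0))) s t s' ∧
        σ.clk + e.cost + t ≤ σ'.clk ∧ Rel m σ' s' ∧ Q σ' := by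
    intro k
    induction k using Nat.strong_induction_on with
    | _ k ih =>
      intro σ s hI hs hr
      by_cases hz : e.eval σ = 0
      · exact ⟨_, _, _, Exec.loopStop (hr.trans hz), (by simp [add_assoc] :
          σ.clk + e.cost + 1 ≤ (σ.tick (e.cost + 1)).clk),
          ⟨hs.fits, hs.blk, hs.vars, hs.arrs⟩, hend k σ hI hz⟩
      · obtain ⟨t, s', σ', h1, h2, h3, k', hk', h4⟩ :=
          hstep k σ hI hz s ⟨hs.fits, hs.blk, hs.vars, hs.arrs⟩
        obtain ⟨s1, x1, k1, v1⟩ := e.exec_compile 0 s' h3 (hok k' σ' h4)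
        obtain ⟨t2, s2, σ2, g1, g2, g3, g4⟩ := ih k' hk' σ' s1 h4 (k1.rel h3) v1
        refine ⟨_, s2, σ2, Exec.loopStep (by rw [hr]; exact hz) (h1.seq x1) g1, ?_, g3, g4⟩
        simp only [St.tick_clk] at h2
        omega
  intro s hs
  obtain ⟨s1, x1, k1, v1⟩ := e.exec_compile 0 s hs (hok k σ h0)
  obtain ⟨t2, s2, σ2, g1, g2, g3, g4⟩ := key k σ s1 h0 (k1.rel hs) v1
  exact ⟨_, s2, σ2, x1.seq g1, by omega, g3, g4⟩

theorem WP.while_ {m : Mach} {e : Expr} {p : Prog} {Q : St → Prop} (I : St → Prop) (μ : St → ℕ)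
    (hok : ∀ σ, I σ → e.Ok m.blk σ)
    (hstep : ∀ σ, I σ → e.eval σ ≠ 0 →
      WP m p (σ.tick (e.cost + 1)) fun σ' => I σ' ∧ μ σ' < μ σ)
    (hend : ∀ σ, I σ → e.eval σ = 0 → Q (σ.tick (e.cost + 1))) {σ : St} (h0 : I σ) :
    WP m (while_ e p) σ Q := by
  refine WP.while_of_index (fun k σ => I σ ∧ μ σ = k) (fun _ σ h => hok σ h.1) ?_
    (fun _ σ h => hend σ h.1) ⟨h0, rfl⟩
  rintro _ σ ⟨h, rfl⟩ hne
  exact (hstep σ h hne).mono fun σ' h' => ⟨μ σ', h'.2, h'.1, rfl⟩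

/-- The rule for counting loops that run `count` times: the invariant `I j` holds when the variable
`x` has the value `j`. -/
theorem WP.for_ {m : Mach} {x count : ℕ} {b : Expr} {p : Prog} {Q : St → Prop}
    (I : ℕ → St → Prop) {σ : St} (hc : count < 16 * m.blk)
    (h0 : I 0 (σ.setVar x 0 2))
    (hb : ∀ j ≤ count, ∀ σ, I j σ → σ.var x = j → b.Ok m.blk σ ∧ b.eval σ = count)
    (hstep : ∀ j < count, ∀ σ, I j σ → σ.var x = j →
      WP m p (σ.tick (b.cost + 3)) fun σ' => σ'.var x = j ∧ I (j + 1) (σ'.setVar x (j + 1) 4))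
    (hend : ∀ σ, I count σ → Q (σ.tick (b.cost + 3))) :
    WP m (for_ x b p) σ Q := by
  have hpos := m.le_blk
  refine WP.seq (WP.assign (by simp; omega) ?_)
  refine WP.while_ (fun σ => ∃ j ≤ count, I j σ ∧ σ.var x = j) (fun σ => count - σ.var x)
    ?_ ?_ ?_ ⟨0, Nat.zero_le _, h0, by simp [St.setVar_var]⟩
  · rintro σ ⟨j, hj, hI, hx⟩
    exact ⟨trivial, (hb j hj σ hI hx).1, trivial⟩
  · rintro σ ⟨j, hj, hI, hx⟩ hne
    have hlt : j < count := by
      by_contra hcon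
      simp [(hb j hj σ hI hx).2, hx, hcon] at hne
    have hcost : (Expr.bin .lt (.var x) b).cost + 1 = b.cost + 3 := by simp; omega
    rw [hcost]
    refine WP.seq ((hstep j hlt σ hI hx).mono ?_)
    · rintro σ' ⟨hx', hI'⟩
      refine WP.assign ⟨trivial, by simp; omega, by simp; omega⟩ ?_
      simp only [Expr.eval, Op.val, hx']
      exact ⟨⟨j + 1, hlt, hI', by simp [St.setVar_var]⟩, by simp [St.setVar_var, hx]; omega⟩
  · rintro σ ⟨j, hj, hI, hx⟩ heq
    have : j = count := by
      by_contra hcon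
      simp [(hb j hj σ hI hx).2, hx] at heq
      omega
    subst this
    have hcost : (Expr.bin .lt (.var x) b).cost + 1 = b.cost + 3 := by simp; omega
    rw [hcost]
    exact hend σ hI

end WordRAM

namespace StringIndex

section Strings

/-! ### Occurrences and end positions in the reversed string -/

variable {α : Type*}

/-- The occurrences of `x` in `y`, as the numbers of characters in front of them. -/
def Occ (y x : List α) : Set ℕ := {k | k ≤ y.length ∧ x <+: y.drop k}

theorem occ_mono {y x x' : List α} (h : x <+: x') : Occ y x' ⊆ Occ y x :=
  fun _ hk => ⟨hk.1, h.trans hk.2⟩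

theorem prefix_of_mem_occ {y x x' : List α} {k : ℕ} (h : k ∈ Occ y x) (h' : k ∈ Occ y x')
    (hl : x.length ≤ x'.length) : x <+: x' := List.prefix_of_prefix_length_le h.2 h'.2 hl

theorem mem_occ_cons {y x : List α} {b : α} {k : ℕ} :
    k ∈ Occ y (b :: x) ↔ y[k]? = some b ∧ k + 1 ∈ Occ y x := by
  by_cases hk : k < y.length
  · simp only [Occ, Set.mem_ofPred_eq, List.drop_eq_getElem_cons hk, List.cons_prefix_cons,
      List.getElem?_eq_getElem hk, Option.some.injEq]
    constructor
    · rintro ⟨-, rfl, h⟩; exact ⟨rfl, hk, h⟩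
    · rintro ⟨rfl, -, h⟩; exact ⟨hk.le, rfl, h⟩
  · have h1 : y.drop k = [] := List.drop_eq_nil_of_le (by omega)
    simp [Occ, h1, hk]

theorem mem_occ_concat {y x : List α} {a : α} {k : ℕ} :
    k ∈ Occ y (x ++ [a]) ↔ k ∈ Occ y x ∧ y[k + x.length]? = some a := by
  induction x generalizing k with
  | nil =>
    rw [List.nil_append, mem_occ_cons]
    simp only [Occ, List.nil_prefix, and_true, Set.mem_ofPred_eq, List.length_nil, add_zero]
    constructor
    · rintro ⟨h, h'⟩; exact ⟨by omega, h⟩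
    · rintro ⟨h, h'⟩; exact ⟨h', (List.getElem?_eq_some_iff.1 h').1⟩
  | cons b x ih =>
    rw [List.cons_append, mem_occ_cons, ih, mem_occ_cons, List.length_cons,
      show k + 1 + x.length = k + (x.length + 1) by omega, and_assoc]

theorem mem_substr_iff {y x : List α} : x ∈ Substr y ↔ (Occ y x).Nonempty := by
  constructor
  · rintro ⟨u, v, rfl⟩
    exact ⟨u.length, by simp, by simp⟩
  · rintro ⟨k, hk, v, hv⟩
    exact ⟨y.take k, v, by rw [List.append_assoc, hv, List.take_append_drop]⟩

theorem occ_cons_congr {y x x' : List α} (h : Occ y x = Occ y x') (b : α) :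
    Occ y (b :: x) = Occ y (b :: x') := by
  ext k; rw [mem_occ_cons, mem_occ_cons, h]

theorem mem_begPos {y x : List α} {i : ℕ} : i ∈ BegPos y x ↔ 1 ≤ i ∧ i - 1 ∈ Occ y x := by
  simp only [BegPos, Occ, factor, Set.mem_ofPred_eq]
  refine and_congr_right fun hi => ?_
  rw [List.drop_take, List.prefix_iff_eq_take, show i + x.length - 1 - (i - 1) = x.length by omega]
  constructor
  · rintro ⟨h1, h2⟩; exact ⟨by omega, h2.symm⟩
  · rintro ⟨h1, h2⟩
    refine ⟨?_, h2.symm⟩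
    have := congrArg List.length h2
    simp at this
    omega

theorem begPos_eq_iff {y x x' : List α} : BegPos y x = BegPos y x' ↔ Occ y x = Occ y x' := by
  constructor
  · intro h
    ext k
    have := Set.ext_iff.1 h (k + 1)
    simpa [mem_begPos] using this
  · intro h
    ext i
    rw [mem_begPos, mem_begPos, h]

theorem mem_endPos_reverse {y x : List α} {i : ℕ} :
    i ∈ EndPos y.reverse x ↔ i ≤ y.length ∧ y.length - i ∈ Occ y x.reverse := by
  have key : x.length ≤ i → i ≤ y.length →
      (factor y.reverse (i - x.length + 1) i = x ↔ x.reverse <+: y.drop (y.length - i)) := by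
    intro h1 h2
    have h3 : (y.reverse.take i).length = i := by simp [h2]
    rw [factor, Nat.add_sub_cancel, ← List.reverse_suffix, List.reverse_reverse,
      List.suffix_iff_eq_drop, ← List.take_reverse, h3]
    exact eq_comm
  simp only [EndPos, Occ, Set.mem_ofPred_eq, List.length_reverse]
  constructor
  · rintro ⟨h1, h2, h3⟩
    exact ⟨h2, by omega, (key h1 h2).1 h3⟩
  · rintro ⟨h2, -, h3⟩
    have h1 : x.length ≤ i := by
      have := h3.length_le
      simp at this; omega
    exact ⟨h1, h2, (key h1 h2).2 h3⟩

theorem endClass_eq_iff {y x x' : List α} :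
    endClass y.reverse x = endClass y.reverse x' ↔ Occ y x.reverse = Occ y x'.reverse := by
  have h : EndPos y.reverse x = EndPos y.reverse x' ↔ Occ y x.reverse = Occ y x'.reverse := by
    constructor
    · intro h
      ext k
      constructor <;> intro hk
      · have := (Set.ext_iff.1 h (y.length - k)).1
        rw [mem_endPos_reverse, mem_endPos_reverse, Nat.sub_sub_self hk.1] at this
        exact (this ⟨by omega, hk⟩).2
      · have := (Set.ext_iff.1 h (y.length - k)).2
        rw [mem_endPos_reverse, mem_endPos_reverse, Nat.sub_sub_self hk.1] at this
        exact (this ⟨by omega, hk⟩).2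
    · intro h
      ext i
      rw [mem_endPos_reverse, mem_endPos_reverse, h]
  rw [← h]
  constructor
  · intro h'
    exact (h' ▸ (rfl : EndPos y.reverse x = EndPos y.reverse x) : x ∈ endClass y.reverse x')
  · intro h'
    simp only [endClass, h']

theorem reverse_mem_substr {y x : List α} : x ∈ Substr y.reverse ↔ x.reverse ∈ Substr y := by
  have h : ∀ {y x : List α}, x ∈ Substr y → x.reverse ∈ Substr y.reverse := by
    rintro y x ⟨u, v, rfl⟩
    exact ⟨v.reverse, u.reverse, by simp⟩
  exact ⟨fun hx => by simpa using h hx, fun hx => by simpa using h hx⟩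

/-! ### Nodes and edges of the suffix tree -/

/-- The nodes of the suffix tree are the substrings that are not always followed by the same
character. -/
theorem mem_nodes_iff {y z : List α} :
    z ∈ suffixTreeNodes y ↔ z ∈ Substr y ∧ ∀ a, Occ y (z ++ [a]) ≠ Occ y z := by
  constructor
  · rintro ⟨x, hx, h1, h2⟩
    rw [begPos_eq_iff] at h1
    refine ⟨by rw [mem_substr_iff, h1]; exact mem_substr_iff.1 hx, fun a ha => ?_⟩
    have := h2 (z ++ [a]) (begPos_eq_iff.2 (ha.trans h1))
    simp at this
  · rintro ⟨h1, h2⟩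
    refine ⟨z, h1, rfl, fun z' hz' => ?_⟩
    rw [begPos_eq_iff] at hz'
    by_contra! hlt
    obtain ⟨k, hk⟩ := mem_substr_iff.1 h1
    obtain ⟨t, rfl⟩ := prefix_of_mem_occ hk (hz' ▸ hk) hlt.le
    cases t with
    | nil => simp at hlt
    | cons a t =>
      refine h2 a (Set.Subset.antisymm (occ_mono (List.prefix_append _ _)) ?_)
      rw [← hz']
      exact occ_mono ⟨t, by simp⟩

theorem node_length_max {y z z' : List α} (hz : z ∈ suffixTreeNodes y) (h : Occ y z' = Occ y z) :
    z'.length ≤ z.length := by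
  obtain ⟨x, -, h1, h2⟩ := hz
  exact h2 z' ((begPos_eq_iff.2 h).trans h1)

theorem isLongestBeg_iff {y x z : List α} (hx : x ∈ Substr y) :
    IsLongestBeg y x z ↔ z ∈ suffixTreeNodes y ∧ Occ y z = Occ y x := by
  constructor
  · intro h
    exact ⟨⟨x, hx, h⟩, begPos_eq_iff.1 h.1⟩
  · rintro ⟨h1, h2⟩
    exact ⟨begPos_eq_iff.2 h2,
      fun z' hz' => node_length_max h1 ((begPos_eq_iff.1 hz').trans h2.symm)⟩

theorem node_prefix {y z z' : List α} (hz : z ∈ suffixTreeNodes y) (hz' : z' ∈ Substr y)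
    (h : Occ y z' = Occ y z) : z' <+: z := by
  obtain ⟨k, hk⟩ := mem_substr_iff.1 hz'
  exact prefix_of_mem_occ hk (h ▸ hk) (node_length_max hz h)

theorem node_substr {y z : List α} (hz : z ∈ suffixTreeNodes y) : z ∈ Substr y :=
  (mem_nodes_iff.1 hz).1

theorem node_eq {y z z' : List α} (hz : z ∈ suffixTreeNodes y) (hz' : z' ∈ suffixTreeNodes y)
    (h : Occ y z = Occ y z') : z = z' :=
  (node_prefix hz' (node_substr hz) h).eq_of_length_le (node_length_max hz h.symm)

theorem substr_of_prefix {y x x' : List α} (hx : x' ∈ Substr y) (h : x <+: x') : x ∈ Substr y :=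
  mem_substr_iff.2 ((mem_substr_iff.1 hx).mono (occ_mono h))

theorem exists_node {y x : List α} (hx : x ∈ Substr y) :
    ∃ z ∈ suffixTreeNodes y, Occ y z = Occ y x := by
  by_cases h : x ∈ suffixTreeNodes y
  · exact ⟨x, h, rfl⟩
  · rw [mem_nodes_iff] at h
    push Not at h
    obtain ⟨a, ha⟩ := h hx
    have hx' : x ++ [a] ∈ Substr y := by
      rw [mem_substr_iff, ha]; exact mem_substr_iff.1 hx
    have hlen : x.length + 1 ≤ y.length := by
      obtain ⟨u, v, rfl⟩ := hx'
      simp; omega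
    obtain ⟨z, hz, hzo⟩ := exists_node hx'
    exact ⟨z, hz, hzo.trans ha⟩
termination_by y.length - x.length
decreasing_by simp; omega

theorem nil_mem_nodes (y : List α) : [] ∈ suffixTreeNodes y := by
  rw [mem_nodes_iff]
  refine ⟨⟨[], y, rfl⟩, fun a h => ?_⟩
  have : y.length ∈ Occ y [] := ⟨le_rfl, List.nil_prefix⟩
  rw [← h, List.nil_append, mem_occ_cons] at this
  simp at this

/-- The set of nodes is closed under suffixes. -/
theorem node_tail {y z : List α} {b : α} (h : b :: z ∈ suffixTreeNodes y) :
    z ∈ suffixTreeNodes y := by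
  rw [mem_nodes_iff] at h ⊢
  obtain ⟨h1, h2⟩ := h
  constructor
  · obtain ⟨u, v, rfl⟩ := h1
    exact ⟨u ++ [b], v, by simp⟩
  · intro a ha
    exact h2 a (by rw [List.cons_append]; exact occ_cons_congr ha b)

theorem node_of_suffix {y z z' : List α} (h : z ∈ suffixTreeNodes y) (hs : z' <:+ z) :
    z' ∈ suffixTreeNodes y := by
  obtain ⟨t, rfl⟩ := hs
  induction t with
  | nil => exact h
  | cons b t ih => exact ih (node_tail h)

/-- The longest proper prefix `x` of a non-empty string `p` that is a node: the shortest longer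
prefix `x ++ [b]` occurs only where `p` does, as no prefix in between is a node. -/
theorem exists_parent {y : List α} (p : List α) (hp : p ∈ Substr y) (hne : p ≠ []) :
    ∃ x b, x ++ [b] <+: p ∧ x ∈ suffixTreeNodes y ∧ Occ y (x ++ [b]) = Occ y p := by
  induction p using List.reverseRecOn with
  | nil => exact absurd rfl hne
  | append_singleton q c ih =>
    by_cases hq : q ∈ suffixTreeNodes y
    · exact ⟨q, c, List.prefix_rfl, hq, rfl⟩
    · have hqs := substr_of_prefix hp (List.prefix_append q [c])
      have hq' := hq
      rw [mem_nodes_iff] at hq'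
      push Not at hq'
      obtain ⟨a, ha⟩ := hq' hqs
      have hac : a = c := by
        obtain ⟨k, hk⟩ := mem_substr_iff.1 hp
        have hk' := (mem_occ_concat.1 hk)
        have := (mem_occ_concat.1 (ha ▸ hk'.1)).2
        simpa [hk'.2] using this.symm
      subst hac
      have hqne : q ≠ [] := fun h => hq (h ▸ nil_mem_nodes y)
      obtain ⟨x, b, h1, h2, h3⟩ := ih hqs hqne
      exact ⟨x, b, h1.trans (List.prefix_append _ _), h2, h3.trans ha.symm⟩

/-- Every node that is a prefix of the lower end of an edge is that end or a prefix of the upper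
end. -/
theorem prefix_parent {y x γ q : List α} {b : α} (hq : q ∈ suffixTreeNodes y)
    (hz : x ++ b :: γ ∈ suffixTreeNodes y) (ho : Occ y (x ++ [b]) = Occ y (x ++ b :: γ))
    (h : q <+: x ++ b :: γ) : q = x ++ b :: γ ∨ q <+: x := by
  rcases Nat.lt_or_ge x.length q.length with hl | hl
  · left
    have h1 : x ++ [b] <+: q :=
      List.prefix_of_prefix_length_le ⟨γ, by simp⟩ h (by simpa using hl)
    refine node_eq hq hz (Set.Subset.antisymm ?_ (occ_mono h))
    rw [← ho]
    exact occ_mono h1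
  · exact Or.inr (List.prefix_of_prefix_length_le h (List.prefix_append _ _) hl)

theorem mem_edges_iff {y x β z : List α} : (x, β, z) ∈ suffixTreeEdges y ↔
    ∃ b γ, β = b :: γ ∧ z = x ++ b :: γ ∧ x ∈ suffixTreeNodes y ∧ z ∈ suffixTreeNodes y ∧
      Occ y (x ++ [b]) = Occ y z := by
  constructor
  · rintro ⟨x, b, γ, h, hx, hz, hl⟩
    obtain ⟨rfl, rfl, rfl⟩ : _ = x ∧ _ = b :: γ ∧ _ = x ++ b :: γ := by simpa using h
    exact ⟨b, γ, rfl, rfl, hx, hz, (begPos_eq_iff.1 hl.1).symm⟩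
  · rintro ⟨b, γ, rfl, rfl, hx, hz, ho⟩
    refine ⟨x, b, γ, rfl, hx, hz, ?_⟩
    exact (isLongestBeg_iff (substr_of_prefix (node_substr hz) ⟨γ, by simp⟩)).2 ⟨hz, ho.symm⟩

/-! ### Numbers of nodes and of DAWG edges -/

theorem length_le_of_injOn {β : Type*} {l : List β} (hl : l.Nodup) {K : ℕ} (g : β → ℕ)
    (hg : ∀ a ∈ l, ∀ b ∈ l, g a = g b → a = b) (hK : ∀ a ∈ l, g a < K) : l.length ≤ K := by
  have h1 : (l.map g).Nodup := hl.map_on hg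
  have h2 : l.map g ⊆ List.range K := by
    intro k hk
    obtain ⟨a, ha, rfl⟩ := List.mem_map.1 hk
    exact List.mem_range.2 (hK a ha)
  simpa using (List.subperm_of_subset h1 h2).length_le

/-- A node that is not a suffix of `y` is, for some `i`, the longest prefix of `y.drop i` that also
occurs further to the left. -/
theorem exists_branching_position {y z : List α} (hz : z ∈ suffixTreeNodes y) (hs : ¬ z <:+ y) :
    ∃ i ∈ Occ y z, (∃ j < i, j ∈ Occ y z) ∧
      ∀ a, i ∈ Occ y (z ++ [a]) → ∀ j < i, j ∉ Occ y (z ++ [a]) := by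
  classical
  obtain ⟨hsub, hbr⟩ := mem_nodes_iff.1 hz
  have hne := mem_substr_iff.1 hsub
  set j₀ := Nat.find hne with hj₀
  have hj : j₀ ∈ Occ y z := Nat.find_spec hne
  have hex : ∃ k, k ∈ Occ y z ∧ y[k + z.length]? ≠ y[j₀ + z.length]? := by
    by_contra! hall
    cases hn : y[j₀ + z.length]? with
    | none =>
      rw [List.getElem?_eq_none_iff] at hn
      apply hs
      have : z = y.drop j₀ := hj.2.eq_of_length_le (by simp; omega)
      rw [this]
      exact List.drop_suffix _ _
    | some a =>
      refine hbr a (Set.Subset.antisymm (occ_mono (List.prefix_append _ _)) fun k hk => ?_)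
      exact mem_occ_concat.2 ⟨hk, (hall k hk).trans hn⟩
  set i := Nat.find hex with hi
  have hi' : i ∈ Occ y z ∧ y[i + z.length]? ≠ y[j₀ + z.length]? := Nat.find_spec hex
  refine ⟨i, hi'.1, ⟨j₀, lt_of_le_of_ne (Nat.find_min' hne hi'.1) ?_, hj⟩, ?_⟩
  · intro h
    exact hi'.2 (by rw [h])
  · intro a ha j hji hja
    refine Nat.find_min hex hji ⟨(mem_occ_concat.1 hja).1, ?_⟩
    rw [(mem_occ_concat.1 hja).2, ← (mem_occ_concat.1 ha).2]
    exact hi'.2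

/-- There are at most `2n + 2` nodes: `n + 1` suffixes of `y`, and at most one node for each
position by `exists_branching_position`. -/
theorem exists_node_numbering (y : List α) : ∃ f : List α → ℕ,
    Set.InjOn f (suffixTreeNodes y) ∧ ∀ z ∈ suffixTreeNodes y, f z < 2 * y.length + 2 := by
  classical
  have hpos : ∀ z, ∃ i, z ∈ suffixTreeNodes y → ¬ z <:+ y → i ∈ Occ y z ∧ (∃ j < i, j ∈ Occ y z) ∧
      ∀ a, i ∈ Occ y (z ++ [a]) → ∀ j < i, j ∉ Occ y (z ++ [a]) := by
    intro z
    by_cases h : z ∈ suffixTreeNodes y ∧ ¬ z <:+ y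
    · obtain ⟨i, hi⟩ := exists_branching_position h.1 h.2
      exact ⟨i, fun _ _ => hi⟩
    · exact ⟨0, fun h1 h2 => absurd ⟨h1, h2⟩ h⟩
  choose p hp using hpos
  have hlt : ∀ z z', z ∈ suffixTreeNodes y → z' ∈ suffixTreeNodes y → ¬ z <:+ y → ¬ z' <:+ y →
      p z = p z' → ¬ z.length < z'.length := by
    intro z z' hz hz' hs hs' heq hl
    obtain ⟨h1, -, h3⟩ := hp z hz hs
    obtain ⟨h1', ⟨j, hj, hj'⟩, -⟩ := hp z' hz' hs'
    rw [← heq] at h1' hj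
    obtain ⟨t, rfl⟩ := prefix_of_mem_occ h1 h1' hl.le
    cases t with
    | nil => simp at hl
    | cons a t =>
      have hpre : z ++ [a] <+: z ++ a :: t := ⟨t, by simp⟩
      exact h3 a (occ_mono hpre h1') j hj (occ_mono hpre hj')
  -- suffixes of `y` are numbered by their lengths, the other nodes by positions
  refine ⟨fun z => if z <:+ y then z.length else y.length + 1 + p z, ?_, ?_⟩
  · intro z hz z' hz' h
    simp only at h
    split_ifs at h with hs hs' hs'
    · exact (List.suffix_of_suffix_length_le hs hs' h.le).eq_of_length h
    · have := hs.length_le; omega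
    · have := hs'.length_le; omega
    · have h' : p z = p z' := by omega
      have h1 := hlt z z' hz hz' hs hs' h'
      have h2 := hlt z' z hz' hz hs' hs h'.symm
      exact (prefix_of_mem_occ (hp z hz hs).1 (h' ▸ (hp z' hz' hs').1) (by omega)).eq_of_length
        (by omega)
  · intro z hz
    simp only
    split_ifs with hs
    · have := hs.length_le; omega
    · have := (hp z hz hs).1.1; omega

/-- There are at most `3n + 3` pairs of a node `x` and a character `b` with a substring `bx`: if
`bx` is a node, then it determines the pair; otherwise an end position `e` of `bx` does, since `x`
is the longest suffix of `y.take e` that is a node. -/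
theorem weiner_links_length_le {y : List α} {l : List (List α × α)} (hl : l.Nodup)
    (h : ∀ e ∈ l, e.1 ∈ suffixTreeNodes y ∧ e.2 :: e.1 ∈ Substr y) :
    l.length ≤ 3 * y.length + 3 := by
  classical
  obtain ⟨f, hf, hfb⟩ := exists_node_numbering y
  have hpos : ∀ e : List α × α, ∃ k, e.2 :: e.1 ∈ Substr y →
      k ≤ y.length ∧ e.2 :: e.1 <:+ y.take k := by
    intro e
    by_cases h : e.2 :: e.1 ∈ Substr y
    · obtain ⟨u, v, huv⟩ := h
      refine ⟨(u ++ e.2 :: e.1).length, fun _ => ⟨?_, ?_⟩⟩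
      · rw [huv]; simp
      · rw [huv, List.take_left' rfl]
        exact List.suffix_append _ _
    · exact ⟨0, fun h' => absurd h' h⟩
  choose p hp using hpos
  refine length_le_of_injOn hl
    (fun e => if e.2 :: e.1 ∈ suffixTreeNodes y then f (e.2 :: e.1) else 2 * y.length + 2 + p e)
    ?_ ?_
  · rintro ⟨x, b⟩ he ⟨x', b'⟩ he' heq
    have h1 := h _ he
    have h2 := h _ he'
    simp only at heq h1 h2
    split_ifs at heq with hn hn' hn'
    · have := hf hn hn' heq
      simp at this
      simp [this]
    · have := hfb _ hn; omega
    · have := hfb _ hn'; omega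
    · have q1 := (hp (x, b) h1.2).2
      have q2 := (hp (x', b') h2.2).2
      rw [show p (x, b) = p (x', b') by omega] at q1
      simp only at q1 q2
      -- if `x` were shorter than `x'`, then `b :: x` would be a suffix of the node `x'`
      rcases lt_trichotomy x.length x'.length with hlt | hle | hlt
      · exact absurd (node_of_suffix h2.1 (List.suffix_of_suffix_length_le q1
          ((List.suffix_cons _ _).trans q2) (by simpa using hlt))) hn
      · have := (List.suffix_of_suffix_length_le q1 q2 (by simp [hle])).eq_of_length (by simp [hle])
        simp at this
        simp [this]
      · exact absurd (node_of_suffix h1.1 (List.suffix_of_suffix_length_le q2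
          ((List.suffix_cons _ _).trans q1) (by simpa using hlt))) hn'
  · rintro ⟨x, b⟩ he
    have h1 := h _ he
    simp only
    split_ifs with hn
    · have := hfb _ hn; omega
    · have := (hp (x, b) h1.2).1; omega

end Strings

end StringIndex

namespace StringIndex

/-! ### The stored suffix tree -/

/-- `l` lists the nodes on the way from `v` along `par` to `halt`, without `halt`. -/
inductive Walk (par : ℕ → ℕ) (halt : ℕ) : ℕ → List ℕ → Prop
  | nil : Walk par halt halt []
  | cons {v : ℕ} {l : List ℕ} : v ≠ halt → Walk par halt (par v) l → Walk par halt v (v :: l)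

namespace TreeData.Represents

variable {T : TreeData} {y : List ℕ} {node : ℕ → List ℕ} (h : T.Represents y node)
include h

theorem node_mem {v : ℕ} (hv : v < T.size) : node v ∈ suffixTreeNodes y := h.nodes.mapsTo hv

theorem node_inj {u v : ℕ} (hu : u < T.size) (hv : v < T.size) (huv : node u = node v) : u = v :=
  h.nodes.injOn hu hv huv

theorem exists_index {z : List ℕ} (hz : z ∈ suffixTreeNodes y) : ∃ v < T.size, node v = z :=
  h.nodes.surjOn hz

theorem size_le : T.size ≤ 2 * y.length + 2 := by
  obtain ⟨f, hf, hfb⟩ := exists_node_numbering y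
  have := length_le_of_injOn (l := List.range T.size) List.nodup_range (fun v => f (node v))
    (fun a ha b hb hab => h.node_inj (List.mem_range.1 ha) (List.mem_range.1 hb)
      (hf (h.node_mem (List.mem_range.1 ha)) (h.node_mem (List.mem_range.1 hb)) hab))
    (fun a ha => hfb _ (h.node_mem (List.mem_range.1 ha)))
  simpa using this

theorem edge_spec {e : TreeEdge} (he : e ∈ T.edges) :
    e.src < T.size ∧ e.dst < T.size ∧ ∃ b γ, factor y e.i e.j = b :: γ ∧
      node e.dst = node e.src ++ b :: γ ∧ Occ y (node e.src ++ [b]) = Occ y (node e.dst) ∧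
      y[e.i - 1]? = some b := by
  obtain ⟨h1, h2, h3, h4, h5⟩ := h.edges_range e he
  have := (h.edges.2 _).1 (List.mem_map_of_mem he)
  obtain ⟨b, γ, hb, hz, -, -, ho⟩ := mem_edges_iff.1 this
  refine ⟨h1, h2, b, γ, hb, hz, ho, ?_⟩
  have h6 : (factor y e.i e.j)[0]? = some b := by rw [hb]; rfl
  rw [factor, List.getElem?_drop, List.getElem?_take_of_lt (by omega)] at h6
  simpa using h6

theorem edge_dst_inj {e e' : TreeEdge} (he : e ∈ T.edges) (he' : e' ∈ T.edges)
    (hd : e.dst = e'.dst) : e = e' := by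
  obtain ⟨h1, h2, b, γ, hb, hz, ho, -⟩ := h.edge_spec he
  obtain ⟨h1', h2', b', γ', hb', hz', ho', -⟩ := h.edge_spec he'
  have hpre : node e'.src <+: node e.src ++ b :: γ := by
    rw [← hz, hd, hz']; exact List.prefix_append _ _
  have hpre' : node e.src <+: node e'.src ++ b' :: γ' := by
    rw [← hz', ← hd, hz]; exact List.prefix_append _ _
  have k1 : node e'.src <+: node e.src := by
    rcases prefix_parent (h.node_mem h1') (hz ▸ h.node_mem h2) (hz ▸ ho) hpre with k | k
    · rw [← hz, hd, hz'] at k; simp at k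
    · exact k
  have k2 : node e.src <+: node e'.src := by
    rcases prefix_parent (h.node_mem h1) (hz' ▸ h.node_mem h2') (hz' ▸ ho') hpre' with k | k
    · rw [← hz', ← hd, hz] at k; simp at k
    · exact k
  have hsrc : node e.src = node e'.src := k2.eq_of_length_le k1.length_le
  have hlab : b :: γ = b' :: γ' := by
    rw [hd, hz', hsrc] at hz
    exact (List.append_cancel_left hz).symm
  exact List.inj_on_of_nodup_map h.edges.1 he he' (by rw [hsrc, hb, hb', hlab, hd])

theorem exists_edge {v : ℕ} (hv : v < T.size) (hr : v ≠ T.root) : ∃ e ∈ T.edges, e.dst = v := by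
  have hne : node v ≠ [] := fun hn =>
    hr (h.node_inj hv h.root_lt (hn.trans h.root_eq.symm))
  obtain ⟨x, b, ⟨γ, hγ⟩, hx, ho⟩ := exists_parent _ (node_substr (h.node_mem hv)) hne
  have hmem : (x, b :: γ, node v) ∈ suffixTreeEdges y :=
    mem_edges_iff.2 ⟨b, γ, rfl, by simp [← hγ], hx, h.node_mem hv, ho⟩
  obtain ⟨e, he, heq⟩ := List.mem_map.1 ((h.edges.2 _).2 hmem)
  simp only [Prod.mk.injEq] at heq
  exact ⟨e, he, h.node_inj (h.edge_spec he).2.1 hv heq.2.2⟩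

theorem edge_dst_ne_root {e : TreeEdge} (he : e ∈ T.edges) : e.dst ≠ T.root := by
  obtain ⟨-, -, b, γ, -, hz, -⟩ := h.edge_spec he
  intro hr
  rw [hr, h.root_eq] at hz
  simp at hz

theorem edges_length_le : T.edges.length ≤ T.size :=
  length_le_of_injOn (List.Nodup.of_map _ h.edges.1) TreeEdge.dst
    (fun _ ha _ hb hab => h.edge_dst_inj ha hb hab) fun _ he => (h.edge_spec he).2.1

theorem link_spec {l : TreeLink} (hl : l ∈ T.links) :
    l.src < T.size ∧ l.dst < T.size ∧ node l.src = l.label :: node l.dst := by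
  obtain ⟨h1, h2⟩ := h.links_range l hl
  obtain ⟨a, x, heq, -, -⟩ := (h.links.2 _).1 (List.mem_map_of_mem hl)
  simp only [Prod.mk.injEq] at heq
  exact ⟨h1, h2, by rw [heq.1, heq.2.1, heq.2.2]⟩

theorem link_src_inj {l l' : TreeLink} (hl : l ∈ T.links) (hl' : l' ∈ T.links)
    (hs : l.src = l'.src) : l = l' := by
  have h1 := (h.link_spec hl).2.2
  rw [hs, (h.link_spec hl').2.2] at h1
  simp only [List.cons.injEq] at h1
  exact List.inj_on_of_nodup_map h.links.1 hl hl' (by rw [hs, h1.1, h1.2])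

theorem links_length_le : T.links.length ≤ T.size :=
  length_le_of_injOn (List.Nodup.of_map _ h.links.1) TreeLink.src
    (fun _ ha _ hb hab => h.link_src_inj ha hb hab) fun _ hl => (h.link_spec hl).1

theorem exists_link {v : ℕ} (hv : v < T.size) {b : ℕ} {x : List ℕ} (hn : node v = b :: x) :
    ∃ l ∈ T.links, l.src = v ∧ l.label = b ∧ node l.dst = x := by
  have hbx : b :: x ∈ suffixTreeNodes y := hn ▸ h.node_mem hv
  obtain ⟨l, hl, heq⟩ := List.mem_map.1 ((h.links.2 (b :: x, b, x)).2
    ⟨b, x, rfl, node_tail hbx, hbx⟩)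
  simp only [Prod.mk.injEq] at heq
  exact ⟨l, hl, h.node_inj (h.link_spec hl).1 hv (heq.1.trans hn.symm), heq.2.1, heq.2.2⟩

theorem link_src_ne_root {l : TreeLink} (hl : l ∈ T.links) : l.src ≠ T.root := by
  intro hr
  have := (h.link_spec hl).2.2
  rw [hr, h.root_eq] at this
  simp at this

theorem length_lt_size : y.length < T.size := by
  have hsuf : ∀ k, ∃ v < T.size, node v = y.drop k := fun k => by
    refine h.exists_index (mem_nodes_iff.2 ⟨⟨y.take k, [], by simp⟩, fun a ha => ?_⟩)
    rcases le_or_gt k y.length with hk | hk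
    · have h1 : k ∈ Occ y (y.drop k) := ⟨hk, List.prefix_rfl⟩
      rw [← ha] at h1
      simpa using h1.2.length_le
    · have h1 : y.length ∈ Occ y (y.drop k) := ⟨le_rfl, by simp [List.drop_eq_nil_of_le hk.le]⟩
      rw [← ha] at h1
      simpa using h1.2.length_le
  choose f hf hfn using hsuf
  have := length_le_of_injOn (l := List.range (y.length + 1)) List.nodup_range f
    (fun a ha b hb hab => by
      have h1 := congrArg List.length ((hfn a).symm.trans ((congrArg node hab).trans (hfn b)))
      simp at ha hb h1
      omega)
    (fun a _ => hf a)
  simpa using this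

/-! ### Walks along parents -/

/-- The walk from a prefix `V` of `U` along the parents, where the node `p` is a prefix of `bU`: it
meets the nodes that are longer than `p` after `b` has been put in front, and ends at the node `w`
with `p = bw`, or beyond the root if `p` is the root. The entry `T.size`, which is no node, marks
the missing parent and suffix link of the root. -/
theorem exists_walk_of_prefix {par slk : ℕ → ℕ} (hpar : ∀ e ∈ T.edges, par e.dst = e.src)
    (hroot : par T.root = T.size) (hslk : ∀ l ∈ T.links, slk l.src = l.dst)
    (hsroot : slk T.root = T.size) {p b : ℕ} (hp : p < T.size) {U : List ℕ}
    (hpU : node p <+: b :: U) :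
    ∀ (k V : ℕ), V < T.size → (node V).length = k → node V <+: U →
      (node p).length ≤ (node V).length + 1 →
      ∃ ws, Walk par (slk p) V ws ∧ ws.Nodup ∧
        ∀ X, X ∈ ws ↔ X < T.size ∧ node X <+: node V ∧ (node p).length < (node X).length + 1 := by
  -- the walk stops at a node `w` with `node p = b :: node w`, or beyond the root
  have hhalt : (p = T.root ∧ slk p = T.size) ∨
      (slk p < T.size ∧ node p = b :: node (slk p)) := by
    by_cases hr : p = T.root
    · exact Or.inl ⟨hr, hr ▸ hsroot⟩
    · right
      cases hn : node p with
      | nil => exact absurd (h.node_inj hp h.root_lt (hn.trans h.root_eq.symm)) hr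
      | cons c x =>
        obtain ⟨l, hl, rfl, -, rfl⟩ := h.exists_link hp hn
        rw [hn, List.cons_prefix_cons] at hpU
        rw [hslk l hl]
        exact ⟨(h.link_spec hl).2.1, by rw [hpU.1]⟩
  intro k
  induction k using Nat.strong_induction_on with
  | _ k ih =>
    rintro V hV rfl hVU hle
    by_cases hVs : V = slk p
    · refine ⟨[], hVs ▸ Walk.nil, List.nodup_nil, fun X => ?_⟩
      simp only [List.not_mem_nil, false_iff, not_and, not_lt]
      intro hX hXV
      rcases hhalt with ⟨-, hs⟩ | ⟨-, hs⟩
      · omega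
      · rw [hs, ← hVs]
        simpa using hXV.length_le
    have hlt : (node p).length < (node V).length + 1 := by
      refine lt_of_le_of_ne hle fun heq => hVs ?_
      rcases hhalt with ⟨hs, -⟩ | ⟨hs, hs'⟩
      · rw [hs, h.root_eq] at heq; simp at heq
      · refine h.node_inj hV hs ?_
        rw [hs'] at hpU heq
        rw [List.cons_prefix_cons] at hpU
        simp only [List.length_cons, Nat.add_right_cancel_iff] at heq
        exact (List.prefix_of_prefix_length_le hVU hpU.2 heq.ge).eq_of_length heq.symm
    by_cases hVr : V = T.root
    · have hp0 : p = T.root := by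
        refine h.node_inj hp h.root_lt (h.root_eq.symm ▸ List.eq_nil_of_length_eq_zero ?_)
        rw [hVr, h.root_eq] at hlt
        simpa using hlt
      have hs : slk p = T.size := hp0 ▸ hsroot
      refine ⟨[V], Walk.cons hVs ?_, by simp, fun X => ?_⟩
      · rw [hVr, hroot, hs]; exact Walk.nil
      · simp only [List.mem_singleton]
        constructor
        · rintro rfl
          exact ⟨hV, List.prefix_rfl, hlt⟩
        · rintro ⟨hX, hXV, -⟩
          rw [hVr, h.root_eq, List.prefix_nil] at hXV
          exact hVr ▸ h.node_inj hX h.root_lt (hXV.trans h.root_eq.symm)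
    obtain ⟨e, he, rfl⟩ := h.exists_edge hV hVr
    obtain ⟨hsrc, -, c, γ, -, hz, ho, -⟩ := h.edge_spec he
    have hsp : node e.src <+: node e.dst := hz ▸ List.prefix_append _ _
    have hlen : (node e.src).length < (node e.dst).length := by rw [hz]; simp
    have hpq : ∀ q, q ∈ suffixTreeNodes y → q <+: node e.dst →
        q = node e.dst ∨ q <+: node e.src := by
      intro q hq hqp
      rw [hz] at hqp ho ⊢
      exact prefix_parent hq (hz ▸ h.node_mem hV) ho hqp
    have hle' : (node p).length ≤ (node e.src).length + 1 := by
      rcases hhalt with ⟨hs, -⟩ | ⟨hs, hs'⟩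
      · rw [hs, h.root_eq]; simp
      · rw [hs'] at hpU hlt ⊢
        rw [List.cons_prefix_cons] at hpU
        simp only [List.length_cons, Nat.add_lt_add_iff_right] at hlt
        rcases hpq _ (h.node_mem hs) (List.prefix_of_prefix_length_le hpU.2 hVU hlt.le) with k | k
        · rw [k] at hlt; omega
        · simpa using k.length_le
    obtain ⟨ws, hw, hnd, hmem⟩ := ih _ hlen e.src hsrc rfl (hsp.trans hVU) hle'
    refine ⟨e.dst :: ws, Walk.cons hVs (by rwa [hpar e he]), ?_, fun X => ?_⟩
    · refine List.nodup_cons.2 ⟨fun hin => ?_, hnd⟩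
      have := ((hmem _).1 hin).2.1.length_le
      omega
    · rw [List.mem_cons, hmem]
      constructor
      · rintro (rfl | ⟨h1, h2, h3⟩)
        · exact ⟨hV, List.prefix_rfl, hlt⟩
        · exact ⟨h1, h2.trans hsp, h3⟩
      · rintro ⟨h1, h2, h3⟩
        rcases hpq _ (h.node_mem h1) h2 with k | k
        · exact Or.inl (h.node_inj h1 hV k)
        · exact Or.inr ⟨h1, k, h3⟩

/-- The walk for a suffix link `(v, b, u)` meets the sources of the DAWG edges into `v`. -/
theorem exists_walk {par slk : ℕ → ℕ} (hpar : ∀ e ∈ T.edges, par e.dst = e.src)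
    (hroot : par T.root = T.size) (hslk : ∀ l ∈ T.links, slk l.src = l.dst)
    (hsroot : slk T.root = T.size) {l : TreeLink} (hl : l ∈ T.links) :
    ∃ ws, Walk par (slk (par l.src)) l.dst ws ∧ ws.Nodup ∧
      ∀ X, X ∈ ws ↔ X < T.size ∧ l.label :: node X ∈ Substr y ∧
        Occ y (l.label :: node X) = Occ y (node l.src) := by
  obtain ⟨hls, hld, hn⟩ := h.link_spec hl
  obtain ⟨e, he, hed⟩ := h.exists_edge hls (h.link_src_ne_root hl)
  obtain ⟨hsrc, -, c, γ, -, hz, ho, -⟩ := h.edge_spec he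
  rw [hed] at hz ho
  have hmem := h.node_mem hls
  have hpU : node e.src <+: l.label :: node l.dst := by
    rw [← hn, hz]; exact List.prefix_append _ _
  have hlen : (node e.src).length ≤ (node l.dst).length + 1 := by
    simpa using hpU.length_le
  obtain ⟨ws, hw, hnd, hm⟩ := h.exists_walk_of_prefix hpar hroot hslk hsroot hsrc hpU _ l.dst hld
    rfl List.prefix_rfl hlen
  refine ⟨ws, by rwa [← hed, hpar e he], hnd, fun X => ?_⟩
  rw [hm]
  refine and_congr_right fun hX => ?_
  constructor
  · rintro ⟨h1, h2⟩
    have h3 : l.label :: node X <+: node l.src := by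
      rw [hn]; simpa [List.cons_prefix_cons] using h1
    have h4 : node e.src ++ [c] <+: l.label :: node X := by
      refine List.prefix_of_prefix_length_le ?_ h3 (by simpa using h2)
      rw [hz]; exact ⟨γ, by simp⟩
    exact ⟨substr_of_prefix (node_substr hmem) h3,
      Set.Subset.antisymm (ho ▸ occ_mono h4) (occ_mono h3)⟩
  · rintro ⟨h1, h2⟩
    have h3 := node_prefix hmem h1 h2
    refine ⟨by rw [hn] at h3; simpa [List.cons_prefix_cons] using h3, ?_⟩
    by_contra! hle
    have h4 : l.label :: node X <+: node e.src :=
      List.prefix_of_prefix_length_le h3 (hz ▸ List.prefix_append _ _) (by simpa using hle)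
    have h5 : node e.src = node l.src := by
      refine node_eq (h.node_mem hsrc) hmem (Set.Subset.antisymm ?_ ?_)
      · rw [← h2]; exact occ_mono h4
      · exact occ_mono (hz ▸ List.prefix_append _ _)
    rw [hz] at h5
    simp at h5

/-! ### The DAWG of the reversed string -/

theorem dawg_bijOn : Set.BijOn (fun v => endClass y.reverse (node v).reverse) (Set.Iio T.size)
    (dawgNodes y.reverse) := by
  refine ⟨?_, ?_, ?_⟩
  · intro v hv
    exact ⟨_, reverse_mem_substr.2 (by simpa using node_substr (h.node_mem hv)), rfl⟩
  · intro u hu v hv huv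
    rw [endClass_eq_iff, List.reverse_reverse, List.reverse_reverse] at huv
    exact h.node_inj hu hv (node_eq (h.node_mem hu) (h.node_mem hv) huv)
  · rintro _ ⟨x, hx, rfl⟩
    obtain ⟨z, hz, ho⟩ := exists_node (reverse_mem_substr.1 hx)
    obtain ⟨v, hv, rfl⟩ := h.exists_index hz
    exact ⟨v, hv, endClass_eq_iff.2 (by simpa using ho)⟩

omit h in
theorem mem_dawgEdges {V b v : ℕ} :
    (endClass y.reverse (node V).reverse, b, endClass y.reverse (node v).reverse) ∈
      dawgEdges y.reverse ↔
    b :: node V ∈ Substr y ∧ Occ y (b :: node V) = Occ y (node v) := by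
  constructor
  · rintro ⟨x, c, heq, h1, h2⟩
    simp only [Prod.mk.injEq] at heq
    obtain ⟨hV, rfl, hv⟩ := heq
    rw [endClass_eq_iff, List.reverse_reverse] at hV hv
    rw [reverse_mem_substr] at h2
    rw [List.reverse_append, List.reverse_singleton, List.singleton_append] at hv h2
    have := occ_cons_congr hV b
    exact ⟨mem_substr_iff.2 (this ▸ mem_substr_iff.1 h2), this.trans hv.symm⟩
  · rintro ⟨h1, h2⟩
    refine ⟨(node V).reverse, b, ?_, ?_, ?_⟩
    · simp only [Prod.mk.injEq, true_and]
      rw [endClass_eq_iff]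
      simp [h2]
    · rw [reverse_mem_substr, List.reverse_reverse]
      obtain ⟨u, w, rfl⟩ := h1
      exact ⟨u ++ [b], w, by simp⟩
    · rw [reverse_mem_substr]
      simpa using h1

theorem mem_dawgLinks {u a v : ℕ} (hu : u < T.size) (hv : v < T.size) :
    (endClass y.reverse (node v).reverse, a, endClass y.reverse (node u).reverse) ∈
      dawgLinks y.reverse ↔
    ∃ e ∈ T.edges, e.dst = v ∧ e.src = u ∧ y[e.i - 1]? = some a := by
  constructor
  · rintro ⟨c, x, heq, h1, h2, h3⟩
    simp only [Prod.mk.injEq] at heq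
    obtain ⟨hV, rfl, hU⟩ := heq
    rw [endClass_eq_iff, List.reverse_reverse, List.reverse_cons] at hV
    rw [endClass_eq_iff, List.reverse_reverse] at hU
    rw [Ne, endClass_eq_iff, List.reverse_cons] at h3
    rw [reverse_mem_substr] at h1 h2
    rw [List.reverse_cons] at h2
    have hxn : x.reverse ∈ suffixTreeNodes y := by
      refine mem_nodes_iff.2 ⟨h1, fun c hc => ?_⟩
      obtain ⟨k, hk⟩ := mem_substr_iff.1 h2
      have hk' := mem_occ_concat.1 hk
      have := (mem_occ_concat.1 (hc ▸ hk'.1)).2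
      rw [hk'.2] at this
      rw [Option.some.injEq] at this
      exact h3 (this ▸ hc)
    have hx := node_eq (h.node_mem hu) hxn hU
    rw [← hx] at hV h2
    obtain ⟨γ, hγ⟩ := node_prefix (h.node_mem hv) h2 hV.symm
    have hmem : (node u, a :: γ, node v) ∈ suffixTreeEdges y :=
      mem_edges_iff.2 ⟨a, γ, rfl, by simp [← hγ], h.node_mem hu, h.node_mem hv, hV.symm⟩
    obtain ⟨e, he, heq⟩ := List.mem_map.1 ((h.edges.2 _).2 hmem)
    simp only [Prod.mk.injEq] at heq
    obtain ⟨hs, hd, b, γ', hb, -, -, hyb⟩ := h.edge_spec he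
    rw [hb, List.cons.injEq] at heq
    exact ⟨e, he, h.node_inj hd hv heq.2.2, h.node_inj hs hu heq.1, by rw [hyb, heq.2.1.1]⟩
  · rintro ⟨e, he, rfl, rfl, hya⟩
    obtain ⟨hs, hd, b, γ, hb, hz, ho, hyb⟩ := h.edge_spec he
    obtain rfl : b = a := by simpa [hya] using hyb.symm
    have hsub : node e.src ++ [b] ∈ Substr y :=
      mem_substr_iff.2 (ho ▸ mem_substr_iff.1 (node_substr (h.node_mem hd)))
    refine ⟨b, (node e.src).reverse, ?_, ?_, ?_, ?_⟩
    · simp only [Prod.mk.injEq, and_true]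
      rw [endClass_eq_iff]
      simp [ho]
    · rw [reverse_mem_substr, List.reverse_reverse]
      exact node_substr (h.node_mem hs)
    · rw [reverse_mem_substr]; simpa using hsub
    · rw [Ne, endClass_eq_iff]
      simp only [List.reverse_cons, List.reverse_reverse, ho]
      intro hcon
      rw [node_eq (h.node_mem hd) (h.node_mem hs) hcon] at hz
      simp at hz

end TreeData.Represents

end StringIndex

/-! ### Lists in arrays -/

namespace WordRAM

/-- The list `l` stands in the array `f` from index `c` on. -/
def Lst (f : ℕ → ℕ) (c : ℕ) (l : List ℕ) : Prop := ∀ (i : ℕ) (h : i < l.length), f (c + i) = l[i]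

theorem lst_nil (f : ℕ → ℕ) (c : ℕ) : Lst f c [] := fun i h => by simp at h

theorem lst_append {f : ℕ → ℕ} {c : ℕ} {l l' : List ℕ} :
    Lst f c (l ++ l') ↔ Lst f c l ∧ Lst f (c + l.length) l' := by
  constructor
  · intro h
    refine ⟨fun i hi => ?_, fun i hi => ?_⟩
    · rw [h i (by simp; omega), List.getElem_append_left hi]
    · rw [add_assoc, h (l.length + i) (by simp; omega), List.getElem_append_right (by omega)]
      simp
  · rintro ⟨h1, h2⟩ i hi
    by_cases hl : i < l.length
    · rw [h1 i hl, List.getElem_append_left hl]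
    · rw [List.getElem_append_right (by omega), ← h2 (i - l.length) (by simp at hi; omega)]
      congr 1; omega

theorem lst_singleton {f : ℕ → ℕ} {c a : ℕ} : Lst f c [a] ↔ f c = a := by
  constructor
  · intro h; exact h 0 (by simp)
  · intro h i hi
    obtain rfl : i = 0 := by simpa using hi
    exact h

theorem lst_cons {f : ℕ → ℕ} {c a : ℕ} {l : List ℕ} :
    Lst f c (a :: l) ↔ f c = a ∧ Lst f (c + 1) l := by
  rw [← List.singleton_append, lst_append, lst_singleton]; rfl

theorem Lst.congr {f g : ℕ → ℕ} {c : ℕ} {l : List ℕ} (h : Lst f c l)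
    (hfg : ∀ i < l.length, g (c + i) = f (c + i)) : Lst g c l :=
  fun i hi => (hfg i hi).trans (h i hi)

theorem Lst.snoc {f : ℕ → ℕ} {c : ℕ} {l : List ℕ} (h : Lst f c l) (v : ℕ) :
    Lst (Function.update f (c + l.length) v) c (l ++ [v]) := by
  refine lst_append.2 ⟨h.congr fun i hi => Function.update_of_ne (by omega) _ _, ?_⟩
  rw [lst_singleton, Function.update_self]

/-- The list `l` is stored as a linked list that starts with the reference `p`: the reference to
the entry `e` is `e + 1`, and `0` is the end of a list. -/
inductive Chain (nxt : ℕ → ℕ) : ℕ → List ℕ → Prop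
  | nil : Chain nxt 0 []
  | cons {e : ℕ} {l : List ℕ} : Chain nxt (nxt e) l → Chain nxt (e + 1) (e :: l)

theorem Chain.congr {nxt nxt' : ℕ → ℕ} {p : ℕ} {l : List ℕ} (h : Chain nxt p l)
    (hn : ∀ e ∈ l, nxt' e = nxt e) : Chain nxt' p l := by
  induction h with
  | nil => exact Chain.nil
  | cons _ ih =>
    refine Chain.cons ?_
    rw [hn _ (by simp)]
    exact ih fun e he => hn e (by simp [he])

/-- The entries of `A` with keys below `k`, stably sorted by their keys. -/
def buckets (key : ℕ → ℕ) (k : ℕ) (A : List ℕ) : List ℕ :=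
  (List.range k).flatMap fun j => A.filter fun e => key e = j

theorem buckets_succ (key : ℕ → ℕ) (k : ℕ) (A : List ℕ) :
    buckets key (k + 1) A = buckets key k A ++ A.filter fun e => key e = k := by
  simp [buckets, List.range_succ]

/-- The induction on `k` splits the keys below `k + 1` into those below `k` and `k` itself. -/
theorem buckets_perm_filter (key : ℕ → ℕ) (k : ℕ) (A : List ℕ) :
    (buckets key k A).Perm (A.filter fun e => key e < k) := by
  induction k with
  | zero => simp [buckets]
  | succ k ih =>
    rw [buckets_succ]
    refine (ih.append_right _).trans ?_
    have := List.filter_append_perm (fun e => decide (key e < k))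
      (A.filter fun e => key e < k + 1)
    rw [List.filter_filter, List.filter_filter] at this
    convert this using 3
    · funext e; rw [Bool.eq_iff_iff]; simp; omega
    · funext e; rw [Bool.eq_iff_iff]; simp; omega

theorem buckets_perm {key : ℕ → ℕ} {k : ℕ} {A : List ℕ} (h : ∀ e ∈ A, key e < k) :
    (buckets key k A).Perm A := by
  refine (buckets_perm_filter key k A).trans ?_
  rw [List.filter_eq_self.2 (by simpa using h)]

theorem buckets_length_le (key : ℕ → ℕ) (k : ℕ) (A : List ℕ) :
    (buckets key k A).length ≤ A.length :=
  (buckets_perm_filter key k A).length_eq.trans_le (List.length_filter_le _ _)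

theorem buckets_congr {key key' : ℕ → ℕ} {k : ℕ} {A : List ℕ} (h : ∀ e ∈ A, key e = key' e) :
    buckets key k A = buckets key' k A := by
  unfold buckets
  congr 1
  funext j
  exact List.filter_congr fun e he => by rw [h e he]

/-! ### The bucket sort

Variable `0` holds the number of records, the other variables are local. The arrays are

* `0` the input, `1` the output;
* `2` the parent of each node, `3` the target of its suffix link, `13` the mark of a node that has a
  parent, `14` the first character of the edge from the parent;
* `5` the source, `4` the label, `6` the target of each record, `7` the part of its label that is
  not yet sorted by, `8` its key for the bucket sort;
* `10` the current order of the records;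
* `9`, `11` the references of the bucket lists, `12` the offsets of the buckets. -/

infixl:65 " +ₑ " => Expr.bin Op.add
infixl:65 " -ₑ " => Expr.bin Op.sub
infixl:70 " *ₑ " => Expr.bin Op.mul
infixl:70 " /ₑ " => Expr.bin Op.div
infixl:70 " %ₑ " => Expr.bin Op.mod
infix:50 " <ₑ " => Expr.bin Op.lt
infix:50 " =ₑ " => Expr.bin Op.eq
infixr:30 " ;; " => Prog.seq
notation "numNodes" => Expr.get 0 (Expr.lit 1)

/-- All buckets become empty. Array `11` holds the references to the first entries. -/
def clearBuckets : Prog := for_ 1 numNodes (put 11 (.var 1) (.lit 0))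

/-- The entries of the list in array `10`, of the length in variable `0`, are put in front of the
buckets for their keys in array `8`, the last entry first. Array `9` holds the references to the
next entries. -/
def fillBuckets : Prog :=
  assign 1 (.var 0) ;;
  while_ (.var 1) (
    assign 1 (.var 1 -ₑ .lit 1) ;;
    assign 2 (.get 10 (.var 1)) ;;
    put 9 (.var 2) (.get 11 (.get 8 (.var 2))) ;;
    put 11 (.get 8 (.var 2)) (.var 2 +ₑ .lit 1))

/-- The bucket with the number in variable `1` is appended to the list in array `10`, whose length
is in variable `2`. -/
def readBucket : Prog :=
  assign 3 (.get 11 (.var 1)) ;;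
  while_ (.var 3) (
    put 10 (.var 2) (.var 3 -ₑ .lit 1) ;;
    assign 2 (.var 2 +ₑ .lit 1) ;;
    assign 3 (.get 9 (.var 3 -ₑ .lit 1)))

/-- The buckets are concatenated in array `10`, and their offsets are written to array `12`. -/
def readBuckets : Prog :=
  assign 2 (.lit 0) ;;
  for_ 1 numNodes (put 12 (.var 1) (.var 2) ;; readBucket) ;;
  put 12 numNodes (.var 2)

/-- A stable sort of the list in array `10` by the keys in array `8`. -/
def bucketSort : Prog := clearBuckets ;; fillBuckets ;; readBuckets

section

variable {m : Mach} {N : ℕ}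

theorem wp_clearBuckets {σ : St} (hN : σ.arr 0 1 = N) (hNb : N < m.blk) :
    WP m clearBuckets σ fun σ' => σ'.var 0 = σ.var 0 ∧ (∀ a, a ≠ 11 → σ'.arr a = σ.arr a) ∧
      (∀ k < N, σ'.arr 11 k = 0) ∧ σ'.clk ≤ σ.clk + 40 * N + 40 := by
  refine WP.for_ (count := N) (fun j σ' => σ'.var 0 = σ.var 0 ∧ (∀ a, a ≠ 11 → σ'.arr a = σ.arr a) ∧
    (∀ k < j, σ'.arr 11 k = 0) ∧ σ'.clk ≤ σ.clk + 40 * j + 2) (by omega) ?_ ?_ ?_ ?_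
  · simp [St.setVar_var]
  · rintro j hj σ' ⟨-, ha, -, -⟩ -
    have := m.le_blk
    simp [ha 0, hN]; omega
  · rintro j hj σ' ⟨hv, ha, hz, hc⟩ hx
    refine WP.put (by omega) (by simp) (by simp [hx]; omega) (by simp; omega) ?_
    simp only [Expr.eval, Expr.cost, St.setArr_var, St.tick_var, St.setVar_clk, St.setArr_clk,
      St.tick_clk, St.setVar_arr, St.setVar_var, St.setArr_arr, St.tick_arr, hx]
    refine ⟨trivial, by simpa using hv, fun a ha' => by simp [ha', ha a ha'], fun k hk => ?_,
      by omega⟩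
    rcases Nat.lt_succ_iff_lt_or_eq.1 hk with h | rfl
    · simp [Function.update_of_ne h.ne, hz k h]
    · simp
  · rintro σ' ⟨hv, ha, hz, hc⟩
    exact ⟨hv, ha, hz, by simp; omega⟩

theorem wp_fillBuckets {σ : St} {A : List ℕ} (hM : σ.var 0 = A.length) (hA : Lst (σ.arr 10) 0 A)
    (hnd : A.Nodup) (hb : ∀ e ∈ A, e < m.blk) (hl : A.length ≤ m.blk)
    (hNb : N < m.blk) (hkey : ∀ e ∈ A, σ.arr 8 e < N) (hz : ∀ k < N, σ.arr 11 k = 0) :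
    WP m fillBuckets σ fun σ' => σ'.var 0 = σ.var 0 ∧
      (∀ a, a ≠ 9 → a ≠ 11 → σ'.arr a = σ.arr a) ∧
      (∀ k < N, Chain (σ'.arr 9) (σ'.arr 11 k) (A.filter fun e => σ.arr 8 e = k)) ∧
      σ'.clk ≤ σ.clk + 60 * A.length + 40 := by
  refine WP.seq (WP.assign (by simp) ?_)
  refine WP.while_ (fun σ' => σ'.var 0 = σ.var 0 ∧
    (∀ a, a ≠ 9 → a ≠ 11 → σ'.arr a = σ.arr a) ∧ σ'.var 1 ≤ A.length ∧
    (∀ k < N, Chain (σ'.arr 9) (σ'.arr 11 k)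
      ((A.drop (σ'.var 1)).filter fun e => σ.arr 8 e = k)) ∧
    σ'.clk ≤ σ.clk + 60 * (A.length - σ'.var 1) + 20) (fun σ' => σ'.var 1) ?_ ?_ ?_ ?_
  · intros; trivial
  · rintro σ' ⟨hv, ha, h1, hch, hc⟩ hne
    obtain ⟨i, hi⟩ : ∃ i, σ'.var 1 = i + 1 := Nat.exists_eq_succ_of_ne_zero (by simpa using hne)
    have hiA : i < A.length := by omega
    have hAi : σ.arr 10 i = A[i] := by simpa using hA i hiA
    have hmem : A[i] ∈ A := List.getElem_mem hiA
    have hbe := hb _ hmem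
    have hke := hkey _ hmem
    refine WP.seq (WP.assign (by simp [hi]; omega) ?_)
    refine WP.seq (WP.assign (by simp [St.setVar_var, hi]; omega) ?_)
    refine WP.seq (WP.put (by omega) (by simp)
      (by simp [St.setVar_var, hi, ha 10, hAi]; omega)
      (by simp [St.setVar_var, hi, ha 10, ha 8, hAi]; omega) ?_)
    refine WP.put (by omega)
      (by simp [St.setVar_var, hi, ha 10, hAi]; omega)
      (by simp [St.setVar_var, St.setArr_arr, hi, ha 10, ha 8, hAi]; omega)
      (by simp [St.setVar_var, hi, ha 10, hAi]; omega) ?_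
    simp only [Expr.eval, Op.val, Expr.cost, St.setArr_var, St.tick_var, St.setVar_clk,
      St.setArr_clk, St.tick_clk, St.setVar_arr, St.setVar_var, St.setArr_arr, St.tick_arr, hi]
    simp only [ne_eq, Nat.reduceEqDiff, if_true, if_false, not_false_eq_true,
      Nat.add_sub_cancel, ha 10, ha 8, hAi, hv, true_and]
    refine ⟨⟨fun a h9 h11 => by simp [h9, h11, ha a h9 h11], by omega, fun k hk => ?_, by omega⟩,
      by omega⟩
    have hdrop : A.drop i = A[i] :: A.drop (i + 1) := List.drop_eq_getElem_cons hiA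
    have hnot : A[i] ∉ A.drop (i + 1) := by
      have := hnd.sublist (List.drop_sublist i A)
      rw [hdrop] at this
      exact (List.nodup_cons.1 this).1
    have hold := hch k hk
    rw [hi] at hold
    have hold' := hold.congr (nxt' := Function.update (σ'.arr 9) A[i] (σ'.arr 11 (σ.arr 8 A[i])))
      fun e he => Function.update_of_ne
        (fun h => hnot (by rw [← h]; exact (List.mem_filter.1 he).1)) _ _
    rw [hdrop]
    by_cases hkk : σ.arr 8 A[i] = k
    · rw [List.filter_cons_of_pos (by simpa using hkk), ← hkk, Function.update_self]
      refine Chain.cons ?_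
      rw [Function.update_self]
      rw [← hkk] at hold'
      exact hold'
    · rw [List.filter_cons_of_neg (by simpa using hkk), Function.update_of_ne (Ne.symm hkk)]
      exact hold'
  · rintro σ' ⟨hv, ha, h1, hch, hc⟩ h0
    simp only [Expr.eval] at h0
    rw [h0] at hch hc
    exact ⟨hv, ha, hch, by simp; omega⟩
  · simp only [Expr.eval, Expr.cost, St.setVar_clk, St.setVar_arr, St.setVar_var]
    refine ⟨by simp, fun _ _ _ => trivial, by simp [hM], fun k hk => ?_, by simp [hM]⟩
    simp only [if_true, hM, List.drop_length, List.filter_nil, hz k hk]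
    exact Chain.nil

theorem wp_readBucket {σ : St} {pre F : List ℕ} (hv2 : σ.var 2 = pre.length)
    (hpre : Lst (σ.arr 10) 0 pre) (hk : σ.var 1 < m.blk)
    (hch : Chain (σ.arr 9) (σ.arr 11 (σ.var 1)) F)
    (hF : ∀ e ∈ F, e < m.blk) (hl : pre.length + F.length ≤ m.blk) :
    WP m readBucket σ fun σ' => σ'.var 0 = σ.var 0 ∧ σ'.var 1 = σ.var 1 ∧
      (∀ a, a ≠ 10 → σ'.arr a = σ.arr a) ∧ σ'.var 2 = (pre ++ F).length ∧
      Lst (σ'.arr 10) 0 (pre ++ F) ∧ σ'.clk ≤ σ.clk + 40 * F.length + 20 := by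
  refine WP.seq (WP.assign (by simp [hk]) ?_)
  refine WP.while_ (fun σ' => ∃ F₁ F₂, F = F₁ ++ F₂ ∧ σ'.var 0 = σ.var 0 ∧ σ'.var 1 = σ.var 1 ∧
    (∀ a, a ≠ 10 → σ'.arr a = σ.arr a) ∧ σ'.var 2 = (pre ++ F₁).length ∧
    Lst (σ'.arr 10) 0 (pre ++ F₁) ∧ Chain (σ.arr 9) (σ'.var 3) F₂ ∧
    σ'.clk ≤ σ.clk + 40 * F₁.length + 10) (fun σ' => pre.length + F.length - σ'.var 2) ?_ ?_ ?_ ?_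
  · intros; trivial
  · rintro σ' ⟨F₁, F₂, rfl, hv0, hv1, ha, h2, hL, hC, hc⟩ hne
    simp only [Expr.eval] at hne
    generalize hp : σ'.var 3 = p at hC hne
    cases hC with
    | nil => exact absurd rfl hne
    | @cons e F₂ hC =>
    have he : e < m.blk := hF e (by simp)
    simp at hl h2
    refine WP.seq (WP.put (by omega) (by simp) (by simp [h2]; omega) (by simp [hp]; omega) ?_)
    refine WP.seq (WP.assign (by simp [h2]; omega) ?_)
    refine WP.assign (by simp [hp, St.setVar_var]; omega) ?_
    simp only [Expr.eval, Op.val, Expr.cost, St.setArr_var, St.tick_var, St.setVar_clk,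
      St.setArr_clk, St.tick_clk, St.setVar_arr, St.setVar_var, St.setArr_arr, St.tick_arr, hp]
    simp [ha 9]
    refine ⟨⟨F₁ ++ [e], F₂, by simp, hv0, hv1, fun a h => by simp [h, ha a h],
      by simp [h2]; omega, ?_, hC, by simp; omega⟩, by omega⟩
    have := hL.snoc e
    rw [zero_add, List.length_append, ← h2] at this
    simpa using this
  · rintro σ' ⟨F₁, F₂, rfl, hv0, hv1, ha, h2, hL, hC, hc⟩ h0
    simp only [Expr.eval] at h0
    rw [h0] at hC
    cases hC
    exact ⟨hv0, hv1, ha, by simpa using h2, by simpa using hL, by simp; omega⟩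
  · refine ⟨[], F, rfl, ?_⟩
    simp [St.setVar_var, hv2, hpre, hch]

theorem wp_readBuckets {σ : St} {A : List ℕ} {key : ℕ → ℕ} (hN : σ.arr 0 1 = N) (hNb : N < m.blk)
    (hb : ∀ e ∈ A, e < m.blk) (hl : A.length ≤ m.blk)
    (hch : ∀ k < N, Chain (σ.arr 9) (σ.arr 11 k) (A.filter fun e => key e = k)) :
    WP m readBuckets σ fun σ' => σ'.var 0 = σ.var 0 ∧
      (∀ a, a ≠ 10 → a ≠ 12 → σ'.arr a = σ.arr a) ∧
      Lst (σ'.arr 10) 0 (buckets key N A) ∧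
      (∀ k ≤ N, σ'.arr 12 k = (buckets key k A).length) ∧
      σ'.clk ≤ σ.clk + 60 * N + 40 * A.length + 40 := by
  refine WP.seq (WP.assign (by simp; omega) (WP.seq ?_))
  refine WP.for_ (count := N) (fun j σ' => σ'.var 0 = σ.var 0 ∧
    (∀ a, a ≠ 10 → a ≠ 12 → σ'.arr a = σ.arr a) ∧
    Lst (σ'.arr 10) 0 (buckets key j A) ∧ σ'.var 2 = (buckets key j A).length ∧
    (∀ k < j, σ'.arr 12 k = (buckets key k A).length) ∧
    σ'.clk ≤ σ.clk + 60 * j + 40 * (buckets key j A).length + 10) (by omega) ?_ ?_ ?_ ?_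
  · simp [St.setVar_var, buckets, lst_nil]
  · rintro j hj σ' ⟨-, ha, -⟩ -
    have := m.le_blk
    simp [ha 0, hN]; omega
  · rintro j hj σ' ⟨hv, ha, hL, h2, hoff, hc⟩ hx
    have hlen := buckets_length_le key (j + 1) A
    rw [buckets_succ, List.length_append] at hlen
    refine WP.seq (WP.put (by omega) (by simp) (by simp [hx]; omega) (by simp) ?_)
    refine (wp_readBucket (pre := buckets key j A) (F := A.filter fun e => key e = j)
      (by simpa using h2) (by simpa [St.setArr_arr] using hL) (by simp [hx]; omega) ?_ ?_
      (by omega)).mono ?_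
    · have := hch j hj
      simpa [St.setArr_arr, hx, ha 9, ha 11] using this
    · exact fun e he => hb e (List.mem_filter.1 he).1
    · rintro σ'' ⟨g0, g1, ga, g2, gL, gc⟩
      simp only [Expr.eval, Expr.cost, St.setArr_var, St.tick_var, St.setArr_clk, St.tick_clk,
        hx] at g0 g1 gc
      rw [buckets_succ]
      refine ⟨g1, by simp [St.setVar_var, g0, hv], fun a h10 h12 => ?_, gL,
        by simp [St.setVar_var, g2], fun k hk => ?_, by simp; omega⟩
      · simp [ga a h10, St.setArr_arr, h12, ha a h10 h12]
      · simp only [St.setVar_arr, ga 12 (by omega), St.setArr_arr, if_true, Expr.eval, St.tick_arr,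
          St.tick_var, hx]
        rcases Nat.lt_succ_iff_lt_or_eq.1 hk with h | rfl
        · rw [Function.update_of_ne h.ne, hoff k h]
        · rw [Function.update_self, h2]
  · rintro σ' ⟨hv, ha, hL, h2, hoff, hc⟩
    have hlen := buckets_length_le key N A
    refine WP.put (by omega) (by simp; have := m.le_blk; omega) (by simp [ha 0, hN, hNb])
      (by simp) ?_
    refine ⟨hv, fun a h10 h12 => by simp [St.setArr_arr, h12, ha a h10 h12],
      by simpa [St.setArr_arr] using hL, fun k hk => ?_, by simp; omega⟩
    simp only [St.setArr_arr, if_true, Expr.eval, St.tick_arr, St.tick_var, ha 0 (by omega)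
      (by omega), hN, h2]
    rcases hk.lt_or_eq with h | rfl
    · rw [Function.update_of_ne h.ne, hoff k h]
    · rw [Function.update_self]

theorem wp_bucketSort {σ : St} {A : List ℕ} (hN : σ.arr 0 1 = N) (hNb : N < m.blk)
    (hM : σ.var 0 = A.length) (hA : Lst (σ.arr 10) 0 A)
    (hnd : A.Nodup) (hb : ∀ e ∈ A, e < m.blk) (hl : A.length ≤ m.blk)
    (hkey : ∀ e ∈ A, σ.arr 8 e < N) :
    WP m bucketSort σ fun σ' => σ'.var 0 = σ.var 0 ∧
      (∀ a, a ≠ 9 → a ≠ 10 → a ≠ 11 → a ≠ 12 → σ'.arr a = σ.arr a) ∧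
      Lst (σ'.arr 10) 0 (buckets (σ.arr 8) N A) ∧
      (∀ k ≤ N, σ'.arr 12 k = (buckets (σ.arr 8) k A).length) ∧
      σ'.clk ≤ σ.clk + 100 * N + 100 * A.length + 120 := by
  refine WP.seq ((wp_clearBuckets hN hNb).mono ?_)
  rintro σ₁ ⟨a0, aa, az, ac⟩
  have a8 := aa 8 (by omega)
  refine WP.seq ((wp_fillBuckets (N := N) (A := A) (a0.trans hM) (by rwa [aa 10 (by omega)])
    hnd hb hl hNb (by rwa [a8]) az).mono ?_)
  rintro σ₂ ⟨b0, ba, bch, bc⟩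
  refine (wp_readBuckets (N := N) (A := A) (key := σ.arr 8)
    (by rw [ba 0 (by omega) (by omega), aa 0 (by omega), hN]) hNb hb hl
    (by rwa [a8] at bch)).mono ?_
  rintro σ₃ ⟨c0, ca, cL, coff, cc⟩
  exact ⟨c0.trans (b0.trans a0), fun a h1 h2 h3 h4 => by rw [ca a h2 h4, ba a h1 h3, aa a h3],
    cL, coff, by omega⟩

end

end WordRAM

/-! ### Reading the suffix tree -/

namespace WordRAM

open StringIndex

/-- The array `f` holds the words of the input, `y` and its suffix tree `T`. -/
structure Input (f : ℕ → ℕ) (T : TreeData) (y : List ℕ) : Prop where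
  length : f 0 = y.length
  size : f 1 = T.size
  root : f 2 = T.root
  edges : f 3 = T.edges.length
  links : f 4 = T.links.length
  char : ∀ i (h : i < y.length), f (5 + i) = y[i]
  edge : ∀ i (h : i < T.edges.length),
    f (5 + y.length + 4 * i) = T.edges[i].src ∧ f (5 + y.length + 4 * i + 1) = T.edges[i].i ∧
    f (5 + y.length + 4 * i + 3) = T.edges[i].dst
  link : ∀ i (h : i < T.links.length),
    f (5 + y.length + 4 * T.edges.length + 3 * i) = T.links[i].src ∧
    f (5 + y.length + 4 * T.edges.length + 3 * i + 1) = T.links[i].label ∧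
    f (5 + y.length + 4 * T.edges.length + 3 * i + 2) = T.links[i].dst

theorem lst_flatMap_const {β : Type*} {f : ℕ → ℕ} {g : β → List ℕ} {d : ℕ} {c : ℕ} {l : List β}
    (hg : ∀ b, (g b).length = d) :
    Lst f c (l.flatMap g) ↔ ∀ i (h : i < l.length), Lst f (c + d * i) (g l[i]) := by
  induction l generalizing c with
  | nil => simp [lst_nil]
  | cons b l ih =>
    rw [List.flatMap_cons, lst_append, hg, ih]
    constructor
    · rintro ⟨h1, h2⟩ i hi
      cases i with
      | zero => simpa using h1
      | succ i =>
        have := h2 i (by simpa using hi)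
        rw [mul_add, mul_one, add_comm (d * i), ← add_assoc]
        simpa using this
    · intro h
      refine ⟨h 0 (by simp), fun i hi => ?_⟩
      have := h (i + 1) (by simpa using hi)
      rw [mul_add, mul_one, add_comm (d * i), ← add_assoc] at this
      simpa using this

theorem flatMap_length_const {β : Type*} {g : β → List ℕ} {d : ℕ} {l : List β}
    (hg : ∀ b, (g b).length = d) : (l.flatMap g).length = d * l.length := by
  simp [List.length_flatMap, hg, mul_comm]

theorem input_of_lst {f : ℕ → ℕ} {T : TreeData} {y : List ℕ} (h : Lst f 0 (T.words y)) :
    Input f T y := by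
  unfold TreeData.words at h
  rw [lst_append, lst_append, lst_append] at h
  obtain ⟨⟨⟨h1, h2⟩, h3⟩, h4⟩ := h
  simp only [lst_cons, lst_nil, and_true] at h1
  rw [List.length_append, List.length_append, flatMap_length_const (d := 4) (fun _ => rfl)] at h4
  rw [List.length_append] at h3
  simp only [List.length_cons, List.length_nil, zero_add, Nat.reduceAdd] at h1 h2 h3 h4
  refine ⟨h1.1, h1.2.1, h1.2.2.1, h1.2.2.2.1, h1.2.2.2.2, h2, fun i hi => ?_, fun i hi => ?_⟩
  · have := (lst_flatMap_const (d := 4) (fun _ => rfl)).1 h3 i hi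
    simp only [lst_cons] at this
    exact ⟨this.1, this.2.1, this.2.2.2.1⟩
  · have := (lst_flatMap_const (d := 3) (fun _ => rfl)).1 h4 i hi
    simp only [lst_cons] at this
    exact ⟨this.1, this.2.1, this.2.2.1⟩

/-- Default entries for all nodes: the number of nodes as parent (array `2`) and suffix link (array
`3`), `0` as mark (array `13`) and first character (array `14`) of the edge from the parent. -/
def initNodes : Prog :=
  for_ 1 numNodes (
    put 2 (.var 1) numNodes ;;
    put 3 (.var 1) numNodes ;;
    put 13 (.var 1) (.lit 0) ;;
    put 14 (.var 1) (.lit 0))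

/-- The parent, the mark `1`, and the first character of the edge from the parent are stored for
all nodes but the root. -/
def readEdges : Prog :=
  for_ 1 (.get 0 (.lit 3)) (
    assign 2 (.lit 5 +ₑ .get 0 (.lit 0) +ₑ .lit 4 *ₑ .var 1) ;;
    assign 3 (.get 0 (.var 2 +ₑ .lit 3)) ;;
    put 2 (.var 3) (.get 0 (.var 2)) ;;
    put 13 (.var 3) (.lit 1) ;;
    put 14 (.var 3) (.get 0 (.lit 4 +ₑ .get 0 (.var 2 +ₑ .lit 1))))

/-- The address of the suffix link with the number in variable `1` goes to variable `2`. -/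
def locateLink : Prog :=
  assign 2 (.lit 5 +ₑ .get 0 (.lit 0) +ₑ .lit 4 *ₑ .get 0 (.lit 3) +ₑ .lit 3 *ₑ .var 1)

/-- The suffix links are stored. -/
def readLinks : Prog :=
  for_ 1 (.get 0 (.lit 4)) (
    locateLink ;;
    put 3 (.get 0 (.var 2)) (.get 0 (.var 2 +ₑ .lit 2)))

/-- The arrays with the parents, the marks, the characters and the suffix links are complete. -/
structure TreeRead (arr : ℕ → ℕ → ℕ) (T : TreeData) (y : List ℕ) : Prop where
  input : Input (arr 0) T y
  par : ∀ e ∈ T.edges, arr 2 e.dst = e.src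
  mark : ∀ e ∈ T.edges, arr 13 e.dst = 1
  first : ∀ e ∈ T.edges, y[e.i - 1]? = some (arr 14 e.dst)
  par_root : arr 2 T.root = T.size
  mark_root : arr 13 T.root = 0
  first_root : arr 14 T.root = 0
  link : ∀ l ∈ T.links, arr 3 l.src = l.dst
  link_root : arr 3 T.root = T.size

theorem mem_take_succ {β : Type*} {l : List β} {j : ℕ} (hj : j < l.length) {e : β} :
    e ∈ l.take (j + 1) ↔ e ∈ l.take j ∨ e = l[j] := by
  rw [← List.take_concat_get' l j hj, List.mem_append, List.mem_singleton]

/-- `T` is the suffix tree of the non-empty string `y`, and the arrays have the length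
`64 * y.length`. -/
structure Setting (m : Mach) (T : TreeData) (y : List ℕ) (node : ℕ → List ℕ) : Prop where
  rep : T.Represents y node
  pos : 1 ≤ y.length
  blk : m.blk = 64 * y.length

namespace Setting

variable {m : Mach} {T : TreeData} {y : List ℕ} {node : ℕ → List ℕ} (h : Setting m T y node)
include h

theorem bounds : T.size ≤ 4 * y.length ∧ T.edges.length ≤ 4 * y.length ∧
    T.links.length ≤ 4 * y.length ∧ 1 ≤ y.length ∧ m.blk = 64 * y.length := by
  have h1 := h.rep.size_le
  have h2 := h.rep.edges_length_le
  have h3 := h.rep.links_length_le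
  have h4 := h.pos
  have h5 := h.blk
  omega

theorem wp_initNodes {σ : St} (hin : Input (σ.arr 0) T y) :
    WP m initNodes σ fun σ' => σ'.arr 0 = σ.arr 0 ∧
      (∀ v < T.size, σ'.arr 2 v = T.size ∧ σ'.arr 3 v = T.size ∧ σ'.arr 13 v = 0 ∧
        σ'.arr 14 v = 0) ∧ σ'.clk ≤ σ.clk + 100 * T.size + 20 := by
  obtain ⟨b1, b2, b3, b4, b5⟩ := h.bounds
  refine WP.for_ (count := T.size) (fun j σ' => σ'.arr 0 = σ.arr 0 ∧
    (∀ v < j, σ'.arr 2 v = T.size ∧ σ'.arr 3 v = T.size ∧ σ'.arr 13 v = 0 ∧ σ'.arr 14 v = 0) ∧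
    σ'.clk ≤ σ.clk + 100 * j + 2) (by omega) ?_ ?_ ?_ ?_
  · simp
  · rintro j hj σ' ⟨ha, -, -⟩ -
    simp [ha, hin.size]; omega
  · rintro j hj σ' ⟨ha, hv, hc⟩ hx
    have hs := hin.size
    refine WP.seq (WP.put (by omega) (by simp) (by simp [hx]; omega) (by simp; omega) ?_)
    refine WP.seq (WP.put (by omega) (by simp) (by simp [hx]; omega) (by simp; omega) ?_)
    refine WP.seq (WP.put (by omega) (by simp) (by simp [hx]; omega) (by simp; omega) ?_)
    refine WP.put (by omega) (by simp) (by simp [hx]; omega) (by simp; omega) ?_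
    simp [St.setArr_arr, hx, ha, hs]
    refine ⟨fun v hvj => ?_, by omega⟩
    rcases hvj.lt_or_eq with hlt | rfl
    · simpa [Function.update_of_ne hlt.ne] using hv v hlt
    · simp
  · rintro σ' ⟨ha, hv, hc⟩
    exact ⟨ha, hv, by simp; omega⟩

theorem wp_readEdges {σ : St} (hin : Input (σ.arr 0) T y)
    (h0 : ∀ v < T.size, σ.arr 2 v = T.size ∧ σ.arr 3 v = T.size ∧ σ.arr 13 v = 0 ∧
      σ.arr 14 v = 0) :
    WP m readEdges σ fun σ' => σ'.arr 0 = σ.arr 0 ∧ σ'.arr 3 = σ.arr 3 ∧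
      (∀ e ∈ T.edges, σ'.arr 2 e.dst = e.src ∧ σ'.arr 13 e.dst = 1 ∧
        y[e.i - 1]? = some (σ'.arr 14 e.dst)) ∧
      (σ'.arr 2 T.root = T.size ∧ σ'.arr 13 T.root = 0 ∧ σ'.arr 14 T.root = 0) ∧
      σ'.clk ≤ σ.clk + 150 * T.edges.length + 20 := by
  obtain ⟨b1, b2, b3, b4, b5⟩ := h.bounds
  -- the root is not the lower end of an edge, so its entries stay as they are
  have hr := h0 T.root h.rep.root_lt
  refine WP.for_ (count := T.edges.length) (fun j σ' => σ'.arr 0 = σ.arr 0 ∧ σ'.arr 3 = σ.arr 3 ∧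
      (∀ e ∈ T.edges.take j, σ'.arr 2 e.dst = e.src ∧ σ'.arr 13 e.dst = 1 ∧
        y[e.i - 1]? = some (σ'.arr 14 e.dst)) ∧
      (σ'.arr 2 T.root = T.size ∧ σ'.arr 13 T.root = 0 ∧ σ'.arr 14 T.root = 0) ∧
      σ'.clk ≤ σ.clk + 150 * j + 2) (by omega) ?_ ?_ ?_ ?_
  · simp [hr]
  · rintro j hj σ' ⟨ha, -⟩ -
    simp [ha, hin.edges]; omega
  · rintro j hj σ' ⟨ha, ha3, he, hroot, hc⟩ hx
    have hlen := hin.length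
    obtain ⟨e1, e2, e3⟩ := hin.edge j hj
    have hmem : T.edges[j] ∈ T.edges := List.getElem_mem hj
    obtain ⟨r1, r2, r3, r4, r5⟩ := h.rep.edges_range _ hmem
    -- positions in `y` count from `1`, so `y[i]` stands at the address `4 + i`
    have hch : σ.arr 0 (4 + T.edges[j].i) = y[T.edges[j].i - 1] := by
      rw [← hin.char (T.edges[j].i - 1) (by omega)]; congr 1; omega
    refine WP.seq (WP.assign (by simp [ha, hlen, hx]; omega) ?_)
    refine WP.seq (WP.assign (by simp [ha, hlen, hx, St.setVar_var]; omega) ?_)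
    refine WP.seq (WP.put (by omega) (by simp) (by simp [ha, hlen, hx, St.setVar_var, e3]; omega)
      (by simp [ha, hlen, hx, St.setVar_var]; omega) ?_)
    refine WP.seq (WP.put (by omega) (by simp) (by simp [ha, hlen, hx, St.setVar_var, e3]; omega)
      (by simp; omega) ?_)
    refine WP.put (by omega) (by simp) (by simp [ha, hlen, hx, St.setVar_var, e3]; omega)
      (by simp [ha, hlen, hx, St.setVar_var, St.setArr_arr, e2]; omega) ?_
    simp [ha, ha3, hlen, hx, St.setVar_var, St.setArr_arr, e1, e2, e3, hch]
    refine ⟨fun e hem => ?_, ?_, by omega⟩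
    · by_cases hd : e.dst = T.edges[j].dst
      · obtain rfl := h.rep.edge_dst_inj (List.mem_of_mem_take hem) hmem hd
        simp
      · have hem' : e ∈ T.edges.take j :=
          ((mem_take_succ hj).1 hem).resolve_right fun hcon => hd (by rw [hcon])
        simpa [Function.update_of_ne hd] using he e hem'
    · have hne := (h.rep.edge_dst_ne_root hmem).symm
      simpa [Function.update_of_ne hne] using hroot
  · rintro σ' ⟨ha, ha3, he, hroot, hc⟩
    exact ⟨ha, ha3, by simpa using he, hroot, by simp; omega⟩

theorem wp_locateLink {σ : St} (hin : Input (σ.arr 0) T y) (hj : σ.var 1 < T.links.length)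
    {Q : St → Prop} (hQ : Q (σ.setVar 2
      (5 + y.length + 4 * T.edges.length + 3 * σ.var 1) 20)) : WP m locateLink σ Q := by
  obtain ⟨b1, b2, b3, b4, b5⟩ := h.bounds
  refine WP.assign (by simp [hin.length, hin.edges]; omega) ?_
  simpa [hin.length, hin.edges] using hQ

theorem wp_readLinks {σ : St} (hin : Input (σ.arr 0) T y) (hr : σ.arr 3 T.root = T.size) :
    WP m readLinks σ fun σ' => (∀ a, a ≠ 3 → σ'.arr a = σ.arr a) ∧
      (∀ l ∈ T.links, σ'.arr 3 l.src = l.dst) ∧ σ'.arr 3 T.root = T.size ∧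
      σ'.clk ≤ σ.clk + 100 * T.links.length + 20 := by
  obtain ⟨b1, b2, b3, b4, b5⟩ := h.bounds
  refine WP.for_ (count := T.links.length) (fun j σ' => (∀ a, a ≠ 3 → σ'.arr a = σ.arr a) ∧
      (∀ l ∈ T.links.take j, σ'.arr 3 l.src = l.dst) ∧ σ'.arr 3 T.root = T.size ∧
      σ'.clk ≤ σ.clk + 100 * j + 2) (by omega) ?_ ?_ ?_ ?_
  · simp [hr]
  · rintro j hj σ' ⟨ha, -⟩ -
    simp [ha 0, hin.links]; omega
  · rintro j hj σ' ⟨ha, hl, hroot, hc⟩ hx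
    obtain ⟨e1, e2, e3⟩ := hin.link j hj
    have hmem : T.links[j] ∈ T.links := List.getElem_mem hj
    obtain ⟨r1, r2⟩ := h.rep.links_range _ hmem
    refine WP.seq (h.wp_locateLink (by simpa [ha 0] using hin) (by simpa [hx] using hj) ?_)
    refine WP.put (by omega) (by simp [hx, St.setVar_var]; omega)
      (by simp [hx, St.setVar_var, ha 0, e1]; omega) (by simp [hx, St.setVar_var]; omega) ?_
    simp [hx, St.setVar_var, St.setArr_arr, ha 0, e1, e3]
    refine ⟨fun a h3 => by simp [h3, ha a h3], fun l hlm => ?_, ?_, by omega⟩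
    · by_cases hd : l.src = T.links[j].src
      · obtain rfl := h.rep.link_src_inj (List.mem_of_mem_take hlm) hmem hd
        simp
      · have hlm' : l ∈ T.links.take j :=
          ((mem_take_succ hj).1 hlm).resolve_right fun hcon => hd (by rw [hcon])
        simpa [Function.update_of_ne hd] using hl l hlm'
    · have hne := (h.rep.link_src_ne_root hmem).symm
      simpa [Function.update_of_ne hne] using hroot
  · rintro σ' ⟨ha, hl, hroot, hc⟩
    exact ⟨ha, by simpa using hl, hroot, by simp; omega⟩

theorem wp_readTree {σ : St} (hin : Input (σ.arr 0) T y) :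
    WP m (initNodes ;; readEdges ;; readLinks) σ fun σ' => TreeRead σ'.arr T y ∧
      σ'.clk ≤ σ.clk + 1460 * y.length := by
  obtain ⟨b1, b2, b3, b4, b5⟩ := h.bounds
  refine WP.seq ((h.wp_initNodes hin).mono ?_)
  rintro σ₁ ⟨a0, av, ac⟩
  have hin₁ : Input (σ₁.arr 0) T y := a0 ▸ hin
  refine WP.seq ((h.wp_readEdges hin₁ av).mono ?_)
  rintro σ₂ ⟨c0, c3, ce, cr, cc⟩
  have hin₂ : Input (σ₂.arr 0) T y := c0 ▸ hin₁
  refine (h.wp_readLinks hin₂ (by rw [c3]; exact (av _ h.rep.root_lt).2.1)).mono ?_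
  rintro σ₃ ⟨da, dl, dr, dc⟩
  rw [← da 2 (by omega), ← da 13 (by omega), ← da 14 (by omega)] at ce cr
  exact ⟨⟨da 0 (by omega) ▸ hin₂, fun e he => (ce e he).1, fun e he => (ce e he).2.1,
    fun e he => (ce e he).2.2, cr.1, cr.2.1, cr.2.2, dl, dr⟩, by omega⟩

end Setting

end WordRAM

/-! ### Finding the DAWG edges -/

namespace WordRAM

open StringIndex

/-- The records `(V, b, v)` of the edges that belong to the suffix link `(v, b, u)`, where `W` gives
the nodes `V` on its walk. -/
def linkRecords (W : TreeLink → List ℕ) (l : TreeLink) : List (ℕ × ℕ × ℕ) :=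
  (W l).map fun V => (V, l.label, l.src)

/-- The records of `R` are stored: the sources in array `5`, the labels in the arrays `4` and `7`,
the targets in array `6`; array `10` lists their numbers. -/
def Recs (arr : ℕ → ℕ → ℕ) (R : List (ℕ × ℕ × ℕ)) : Prop :=
  ∀ i (h : i < R.length), arr 5 i = R[i].1 ∧ arr 4 i = R[i].2.1 ∧ arr 6 i = R[i].2.2 ∧
    arr 7 i = R[i].2.1 ∧ arr 10 i = i

/-- A record is appended for each node on the walk from the node in variable `4` to the one in
variable `5`. The link is stored at the address in variable `2`, variable `3` holds its source,
and variable `0` the number of records. -/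
def walkLink : Prog :=
  while_ ((.var 4 =ₑ .var 5) =ₑ .lit 0) (
    put 5 (.var 0) (.var 4) ;;
    put 4 (.var 0) (.get 0 (.var 2 +ₑ .lit 1)) ;;
    put 6 (.var 0) (.var 3) ;;
    put 7 (.var 0) (.get 0 (.var 2 +ₑ .lit 1)) ;;
    put 10 (.var 0) (.var 0) ;;
    assign 0 (.var 0 +ₑ .lit 1) ;;
    assign 4 (.get 2 (.var 4)))

/-- The records of all DAWG edges, by walks for all suffix links. -/
def makeRecords : Prog :=
  assign 0 (.lit 0) ;;
  for_ 1 (.get 0 (.lit 4)) (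
    locateLink ;;
    assign 3 (.get 0 (.var 2)) ;;
    assign 4 (.get 0 (.var 2 +ₑ .lit 2)) ;;
    assign 5 (.get 3 (.get 2 (.var 3))) ;;
    walkLink)

theorem wp_walkLink {m : Mach} {σ : St} {R : List (ℕ × ℕ × ℕ)} {W : List ℕ} {b : ℕ}
    (hR : Recs σ.arr R) (h0 : σ.var 0 = R.length) (hl : R.length + W.length < m.blk)
    (hW : ∀ X ∈ W, X < m.blk) (hw : Walk (σ.arr 2) (σ.var 5) (σ.var 4) W)
    (h2 : σ.var 2 + 1 < m.blk) (hb : σ.arr 0 (σ.var 2 + 1) = b) :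
    WP m walkLink σ fun σ' => σ'.var 1 = σ.var 1 ∧
      (∀ a, a ≠ 4 → a ≠ 5 → a ≠ 6 → a ≠ 7 → a ≠ 10 → σ'.arr a = σ.arr a) ∧
      Recs σ'.arr (R ++ W.map fun V => (V, b, σ.var 3)) ∧
      σ'.var 0 = R.length + W.length ∧ σ'.clk ≤ σ.clk + 100 * W.length + 10 := by
  refine WP.while_ (fun σ' => ∃ W₁ W₂, W = W₁ ++ W₂ ∧ σ'.var 1 = σ.var 1 ∧ σ'.var 2 = σ.var 2 ∧
    σ'.var 3 = σ.var 3 ∧ σ'.var 5 = σ.var 5 ∧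
    (∀ a, a ≠ 4 → a ≠ 5 → a ≠ 6 → a ≠ 7 → a ≠ 10 → σ'.arr a = σ.arr a) ∧
    Recs σ'.arr (R ++ W₁.map fun V => (V, b, σ.var 3)) ∧
    σ'.var 0 = R.length + W₁.length ∧ Walk (σ.arr 2) (σ.var 5) (σ'.var 4) W₂ ∧
    σ'.clk ≤ σ.clk + 100 * W₁.length) (fun σ' => R.length + W.length - σ'.var 0) ?_ ?_ ?_
    ?_
  · rintro σ' -
    simp; omega
  · rintro σ' ⟨W₁, W₂, rfl, v1, v2, v3, v5, ha, hR', v0, hw', hc⟩ hne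
    have hne' : σ'.var 4 ≠ σ.var 5 := by
      intro hcon
      simp [hcon, v5] at hne
    generalize hV : σ'.var 4 = V at hw' hne'
    cases hw' with
    | nil => exact absurd rfl hne'
    | @cons _ W₂ _ hw' =>
    have hVb : V < m.blk := hW V (by simp)
    simp only [List.length_append, List.length_cons] at hl
    have a0 : σ'.arr 0 = σ.arr 0 := ha 0 (by omega) (by omega) (by omega) (by omega) (by omega)
    have a2 : σ'.arr 2 = σ.arr 2 := ha 2 (by omega) (by omega) (by omega) (by omega) (by omega)
    refine WP.seq (WP.put (by omega) (by simp) (by simp [v0]; omega) (by simp) ?_)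
    refine WP.seq (WP.put (by omega) (by simp) (by simp [v0]; omega) (by simp [v2]; omega) ?_)
    refine WP.seq (WP.put (by omega) (by simp) (by simp [v0]; omega) (by simp) ?_)
    refine WP.seq (WP.put (by omega) (by simp) (by simp [v0]; omega) (by simp [v2]; omega) ?_)
    refine WP.seq (WP.put (by omega) (by simp) (by simp [v0]; omega) (by simp) ?_)
    refine WP.seq (WP.assign (by simp [v0]; omega) ?_)
    refine WP.assign (by simp [St.setVar_var, hV, hVb]) ?_
    simp [St.setVar_var, St.setArr_arr, v0, v1, v2, v3, v5, a0, a2, hV, hb]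
    refine ⟨⟨W₁ ++ [V], W₂, by simp, ?_, ?_, by simp; omega, hw', by simp; omega⟩, by omega⟩
    · intro a h4 h5 h6 h7 h10
      simp [h4, h5, h6, h7, h10, ha a h4 h5 h6 h7 h10]
    · intro i hi
      simp only [St.setArr_arr]
      simp only [List.map_append, ← List.append_assoc, List.map_cons, List.map_nil] at hi ⊢
      by_cases hlt : i < (R ++ W₁.map fun V => (V, b, σ.var 3)).length
      · have hi' := hlt
        simp only [List.length_append, List.length_map] at hi'
        rw [List.getElem_append_left hlt]
        have := hR' i hlt
        simpa [Function.update_of_ne (show i ≠ R.length + W₁.length by omega)] using this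
      · obtain rfl : i = R.length + W₁.length := by simp at hi hlt; omega
        rw [List.getElem_append_right (by simp)]
        simp
  · rintro σ' ⟨W₁, W₂, rfl, v1, v2, v3, v5, ha, hR', v0, hw', hc⟩ heq
    have h45 : σ'.var 4 = σ.var 5 := by
      by_contra hcon
      simp [v5, hcon] at heq
    rw [h45] at hw'
    cases hw' with
    | nil => exact ⟨v1, ha, by simpa using hR', by simpa using v0, by simp; omega⟩
    | cons hcon => exact absurd rfl hcon
  · exact ⟨[], W, by simp [hR, h0, hw]⟩

theorem Setting.wp_makeRecords {m : Mach} {T : TreeData} {y : List ℕ} {node : ℕ → List ℕ}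
    (h : Setting m T y node) {σ : St} (ht : TreeRead σ.arr T y) {W : TreeLink → List ℕ}
    (hW : ∀ l ∈ T.links, Walk (σ.arr 2) (σ.arr 3 (σ.arr 2 l.src)) l.dst (W l))
    (hWs : ∀ l ∈ T.links, ∀ X ∈ W l, X < T.size)
    (hlen : (T.links.flatMap (linkRecords W)).length ≤ 6 * y.length) :
    WP m makeRecords σ fun σ' => Recs σ'.arr (T.links.flatMap (linkRecords W)) ∧
      σ'.var 0 = (T.links.flatMap (linkRecords W)).length ∧
      (∀ a, a ≠ 4 → a ≠ 5 → a ≠ 6 → a ≠ 7 → a ≠ 10 → σ'.arr a = σ.arr a) ∧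
      σ'.clk ≤ σ.clk + 1100 * y.length := by
  obtain ⟨b1, b2, b3, b4, b5⟩ := h.bounds
  have hin := ht.input
  refine WP.seq (WP.assign (by simp; omega) ?_)
  refine WP.for_ (count := T.links.length) (fun j σ' =>
    Recs σ'.arr ((T.links.take j).flatMap (linkRecords W)) ∧
    σ'.var 0 = ((T.links.take j).flatMap (linkRecords W)).length ∧
    (∀ a, a ≠ 4 → a ≠ 5 → a ≠ 6 → a ≠ 7 → a ≠ 10 → σ'.arr a = σ.arr a) ∧
    σ'.clk ≤ σ.clk + 100 * j + 100 * ((T.links.take j).flatMap (linkRecords W)).length + 4)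
    (by omega) ?_ ?_ ?_ ?_
  · simp [St.setVar_var, Recs]
  · rintro j hj σ' ⟨-, -, ha, -⟩ -
    simp [ha 0, hin.links]; omega
  · rintro j hj σ' ⟨hR, h0, ha, hc⟩ hx
    obtain ⟨l1, l2, l3⟩ := hin.link j hj
    have hmem : T.links[j] ∈ T.links := List.getElem_mem hj
    obtain ⟨r1, r2⟩ := h.rep.links_range _ hmem
    obtain ⟨e, he, hed⟩ := h.rep.exists_edge r1 (h.rep.link_src_ne_root hmem)
    have hpar : σ.arr 2 T.links[j].src < T.size := by
      rw [← hed, ht.par e he]; exact (h.rep.edges_range e he).1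
    have a0 : σ'.arr 0 = σ.arr 0 := ha 0 (by omega) (by omega) (by omega) (by omega) (by omega)
    have a2 : σ'.arr 2 = σ.arr 2 := ha 2 (by omega) (by omega) (by omega) (by omega) (by omega)
    have a3 : σ'.arr 3 = σ.arr 3 := ha 3 (by omega) (by omega) (by omega) (by omega) (by omega)
    have hsplit : (T.links.take (j + 1)).flatMap (linkRecords W) =
        (T.links.take j).flatMap (linkRecords W) ++ linkRecords W T.links[j] := by
      rw [← List.take_concat_get' T.links j hj, List.flatMap_append]
      simp
    have hle : ((T.links.take (j + 1)).flatMap (linkRecords W)).length ≤ 6 * y.length := by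
      refine le_trans ?_ hlen
      conv_rhs => rw [← List.take_append_drop (j + 1) T.links, List.flatMap_append]
      rw [List.length_append]; omega
    rw [hsplit] at hle ⊢
    have hlr : (linkRecords W T.links[j]).length = (W T.links[j]).length := by simp [linkRecords]
    rw [List.length_append, hlr] at hle
    refine WP.seq (h.wp_locateLink (by simpa [a0] using hin) (by simpa [hx] using hj) ?_)
    refine WP.seq (WP.assign (by simp [St.setVar_var, hx]; omega) ?_)
    refine WP.seq (WP.assign (by simp [St.setVar_var, hx]; omega) ?_)
    refine WP.seq (WP.assign (by simp [St.setVar_var, hx, a0, a2, l1]; omega) ?_)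
    refine (wp_walkLink (R := (T.links.take j).flatMap (linkRecords W)) (W := W T.links[j])
      (b := T.links[j].label) (by simpa using hR) (by simpa [St.setVar_var] using h0)
      (by omega) (fun X hX => (hWs _ hmem X hX).trans (by omega)) ?_ ?_ ?_).mono ?_
    · simpa [St.setVar_var, hx, a0, a2, a3, l1, l3] using hW _ hmem
    · simp [St.setVar_var, hx]; omega
    · simp [St.setVar_var, hx, a0, l2]
    · rintro σ'' ⟨g1, ga, gR, g0, gc⟩
      simp [St.setVar_var, hx, a0, l1] at g1 ga gR g0 gc
      refine ⟨g1, by simpa [linkRecords] using gR, by simpa [St.setVar_var, hlr] using g0,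
        fun a h4 h5 h6 h7 h10 => ?_, ?_⟩
      · simp [ga a h4 h5 h6 h7 h10, ha a h4 h5 h6 h7 h10]
      · rw [List.length_append, hlr, St.setVar_clk]
        omega
  · rintro σ' ⟨hR, h0, ha, hc⟩
    rw [List.take_length] at hR h0 hc
    exact ⟨hR, by simpa using h0, ha, by simp; omega⟩

/-! ### Sorting the DAWG edges -/

/-- The remainder of the current quotient in array `7` is the key of each record. -/
def setDigits : Prog :=
  for_ 1 (.var 0) (put 8 (.var 1) (.get 7 (.var 1) %ₑ numNodes))

/-- The quotients are divided by the number of nodes; variable `2` counts those that are not yet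
`0`. -/
def divideQuotients : Prog :=
  assign 2 (.lit 0) ;;
  for_ 1 (.var 0) (
    put 7 (.var 1) (.get 7 (.var 1) /ₑ numNodes) ;;
    assign 2 (.var 2 +ₑ (.lit 0 <ₑ .get 7 (.var 1))))

/-- The records are sorted by their labels, a digit to the base of the number of nodes at a time,
from the lowest digit up to the highest that is not `0` in all labels. -/
def sortLabels : Prog :=
  assign 2 (.lit 1) ;;
  while_ (.var 2) (setDigits ;; bucketSort ;; divideQuotients)

/-- The records are sorted by their sources. -/
def sortSources : Prog :=
  for_ 1 (.var 0) (put 8 (.var 1) (.get 5 (.var 1))) ;; bucketSort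

theorem buckets_pairwise {key f : ℕ → ℕ} {k : ℕ} {A : List ℕ}
    (h : A.Pairwise fun a b => f a ≤ f b) :
    (buckets key k A).Pairwise fun a b => key a < key b ∨ key a = key b ∧ f a ≤ f b := by
  rw [buckets, List.pairwise_flatMap]
  constructor
  · intro j _
    refine (h.filter _).imp_of_mem fun ha hb hab => Or.inr ⟨?_, hab⟩
    rw [List.mem_filter] at ha hb
    have h1 := ha.2
    have h2 := hb.2
    simp only [decide_eq_true_eq] at h1 h2
    rw [h1, h2]
  · refine List.pairwise_lt_range.imp fun {i j} hij a ha b hb => Or.inl ?_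
    rw [List.mem_filter] at ha hb
    have h1 := ha.2
    have h2 := hb.2
    simp only [decide_eq_true_eq] at h1 h2
    omega

/-- The step of the radix sort: a list that is sorted by the lowest `p` digits is sorted by the
lowest `p + 1` digits after a bucket sort by digit number `p`. -/
theorem buckets_digit_pairwise {f key : ℕ → ℕ} {N p M : ℕ} {A : List ℕ} (hA : ∀ e ∈ A, e < M)
    (hkey : ∀ e < M, key e = f e / N ^ p % N)
    (h : A.Pairwise fun a b => f a % N ^ p ≤ f b % N ^ p) :
    (buckets key N A).Pairwise fun a b => f a % N ^ (p + 1) ≤ f b % N ^ (p + 1) := by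
  have hmem : ∀ e ∈ buckets key N A, e < M := by
    intro e he
    rw [buckets, List.mem_flatMap] at he
    obtain ⟨_, _, he⟩ := he
    exact hA e (List.mem_filter.1 he).1
  refine (buckets_pairwise (key := key) (k := N) h).imp_of_mem fun {a b} ha hb hab => ?_
  rw [Nat.mod_pow_succ, Nat.mod_pow_succ, ← hkey a (hmem a ha), ← hkey b (hmem b hb)]
  rcases hab with hlt | ⟨heq, hle⟩
  · have hN : 0 < N := by
      rcases Nat.eq_zero_or_pos N with rfl | hN
      · simp [buckets] at ha
      · exact hN
    have h1 : f a % N ^ p < N ^ p := Nat.mod_lt _ (by positivity)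
    have h2 : N ^ p * (key a + 1) ≤ N ^ p * key b := Nat.mul_le_mul_left _ hlt
    rw [mul_add, mul_one] at h2
    generalize f b % N ^ p = r
    omega
  · rw [heq]; omega

section

variable {m : Mach} {N M : ℕ}

theorem wp_setDigits {σ : St} (hN : σ.arr 0 1 = N) (hM : σ.var 0 = M)
    (hMb : M < m.blk) :
    WP m setDigits σ fun σ' => σ'.var 0 = σ.var 0 ∧ (∀ a, a ≠ 8 → σ'.arr a = σ.arr a) ∧
      (∀ e < M, σ'.arr 8 e = σ.arr 7 e % N) ∧ σ'.clk ≤ σ.clk + 60 * M + 20 := by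
  have := m.le_blk
  refine WP.for_ (count := M) (fun j σ' => σ'.var 0 = σ.var 0 ∧
    (∀ a, a ≠ 8 → σ'.arr a = σ.arr a) ∧ (∀ e < j, σ'.arr 8 e = σ.arr 7 e % N) ∧
    σ'.clk ≤ σ.clk + 60 * j + 2) (by omega) ?_ ?_ ?_ ?_
  · simp [St.setVar_var]
  · rintro j hj σ' ⟨h0, -⟩ -
    simp [h0, hM]
  · rintro j hj σ' ⟨h0, ha, he, hc⟩ hx
    refine WP.put (by omega) (by simp) (by simp [hx]; omega) (by simp [hx]; omega) ?_
    simp [St.setVar_var, St.setArr_arr, hx, h0, ha 7, ha 0, hN]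
    refine ⟨fun a h => by simp [h, ha a h], fun e hej => ?_, by omega⟩
    rcases hej.lt_or_eq with hlt | rfl
    · rw [Function.update_of_ne hlt.ne, he e hlt]
    · rw [Function.update_self]
  · rintro σ' ⟨h0, ha, he, hc⟩
    exact ⟨h0, ha, he, by simp; omega⟩

theorem wp_divideQuotients {σ : St} (hN : σ.arr 0 1 = N) (hM : σ.var 0 = M)
    (hMb : M < m.blk) :
    WP m divideQuotients σ fun σ' => σ'.var 0 = σ.var 0 ∧ (∀ a, a ≠ 7 → σ'.arr a = σ.arr a) ∧
      (∀ e < M, σ'.arr 7 e = σ.arr 7 e / N) ∧ (σ'.var 2 = 0 → ∀ e < M, σ'.arr 7 e = 0) ∧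
      (σ'.var 2 ≠ 0 → ∃ e < M, σ'.arr 7 e ≠ 0) ∧ σ'.clk ≤ σ.clk + 60 * M + 20 := by
  have := m.le_blk
  refine WP.seq (WP.assign (by simp; omega) ?_)
  refine WP.for_ (count := M) (fun j σ' => σ'.var 0 = σ.var 0 ∧
    (∀ a, a ≠ 7 → σ'.arr a = σ.arr a) ∧ (∀ e < j, σ'.arr 7 e = σ.arr 7 e / N) ∧
    (∀ e, j ≤ e → σ'.arr 7 e = σ.arr 7 e) ∧ (σ'.var 2 = 0 → ∀ e < j, σ'.arr 7 e = 0) ∧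
    (σ'.var 2 ≠ 0 → ∃ e < j, σ'.arr 7 e ≠ 0) ∧ σ'.var 2 ≤ j ∧
    σ'.clk ≤ σ.clk + 60 * j + 4) (by omega) ?_ ?_ ?_ ?_
  · simp [St.setVar_var]
  · rintro j hj σ' ⟨h0, -⟩ -
    simp [h0, hM]
  · rintro j hj σ' ⟨h0, ha, he, he', hz, hnz, h2, hc⟩ hx
    have hj7 := he' j le_rfl
    refine WP.seq (WP.put (by omega) (by simp) (by simp [hx]; omega) (by simp [hx]; omega) ?_)
    refine WP.assign ?_ ?_
    · simp [hx]
      split_ifs <;> omega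
    simp [St.setVar_var, St.setArr_arr, hx, h0, ha 0, hN, hj7]
    refine ⟨fun a h => by simp [h, ha a h], fun e hej => ?_, fun e hej => ?_, ?_, ?_, ?_, by omega⟩
    · rcases hej.lt_or_eq with hlt | rfl
      · rw [Function.update_of_ne hlt.ne, he e hlt]
      · rw [Function.update_self]
    · rw [Function.update_of_ne (by omega), he' e (by omega)]
    · intro hv2 hq e hej
      rcases hej.lt_or_eq with hlt | rfl
      · rw [Function.update_of_ne hlt.ne, hz hv2 e hlt]
      · rw [Function.update_self, Nat.div_eq_zero_iff]
        omega
    · intro hv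
      by_cases hv2 : σ'.var 2 = 0
      · exact ⟨j, le_rfl, by
          rw [Function.update_self]; exact (Nat.div_pos (hv hv2).2 (hv hv2).1).ne'⟩
      · obtain ⟨e, hej, hne⟩ := hnz hv2
        exact ⟨e, hej.le, by rwa [Function.update_of_ne hej.ne]⟩
    · split_ifs <;> omega
  · rintro σ' ⟨h0, ha, he, he', hz, hnz, h2, hc⟩
    exact ⟨h0, ha, he, hz, hnz, by simp; omega⟩

/-- The digits run out after at most `c + 1` rounds, since the labels are below `N ^ (c + 1)`. -/
theorem wp_sortLabels {σ : St} {c n : ℕ} (hN : σ.arr 0 1 = N) (hNb : N < m.blk) (hM : σ.var 0 = M)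
    (hMb : M < m.blk) (hMn : M ≤ 6 * n) (hNn : N ≤ 4 * n) (hn : 1 ≤ n) (hNpos : 0 < N)
    (hlab : ∀ e < M, σ.arr 4 e < N ^ (c + 1)) (hq : ∀ e < M, σ.arr 7 e = σ.arr 4 e)
    (hord : Lst (σ.arr 10) 0 (List.range M)) :
    WP m sortLabels σ fun σ' => ∃ A : List ℕ, A.Perm (List.range M) ∧ Lst (σ'.arr 10) 0 A ∧
      A.Pairwise (fun a b => σ.arr 4 a ≤ σ.arr 4 b) ∧ σ'.var 0 = σ.var 0 ∧
      (∀ a, a < 7 ∨ 12 < a → σ'.arr a = σ.arr a) ∧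
      σ'.clk ≤ σ.clk + (c + 1) * (3000 * n) + 10 := by
  have hblk := m.le_blk
  refine WP.seq (WP.assign (by simp; omega) ?_)
  -- `p` is the number of digits sorted by so far
  refine WP.while_of_index (fun k σ' => ∃ p A, p + k = c + 1 ∧ A.Perm (List.range M) ∧
    Lst (σ'.arr 10) 0 A ∧ A.Pairwise (fun a b => σ.arr 4 a % N ^ p ≤ σ.arr 4 b % N ^ p) ∧
    (∀ e < M, σ'.arr 7 e = σ.arr 4 e / N ^ p) ∧ (σ'.var 2 = 0 → ∀ e < M, σ'.arr 7 e = 0) ∧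
    (σ'.var 2 ≠ 0 → p ≤ c) ∧ σ'.var 0 = M ∧ (∀ a, a < 7 ∨ 12 < a → σ'.arr a = σ.arr a) ∧
    σ'.clk ≤ σ.clk + p * (3000 * n) + 2) ?_ ?_ ?_ (k := c + 1) ?_
  · intros; trivial
  · rintro k σ' ⟨p, A, hpk, hperm, hL, hs, hq', hz, hnz, h0, ha, hc⟩ hne
    have hpc := hnz hne
    have a0 := ha 0 (by omega)
    have hmem : ∀ e ∈ A, e < M := fun e he => List.mem_range.1 (hperm.mem_iff.1 he)
    have hlen : A.length = M := by simpa using hperm.length_eq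
    refine WP.seq ((wp_setDigits (N := N) (by simpa [a0] using hN) (by simpa using h0) hMb).mono ?_)
    rintro σ₁ ⟨b0, ba, b8, bc⟩
    simp only [St.tick_var, St.tick_arr, St.tick_clk, Expr.cost] at b0 ba b8 bc
    have b8' : ∀ e < M, σ₁.arr 8 e = σ.arr 4 e / N ^ p % N := fun e he => by
      rw [b8 e he, hq' e he]
    refine WP.seq ((wp_bucketSort (N := N) (A := A) (by rw [ba 0 (by omega), a0, hN]) hNb
      (by rw [b0, h0, hlen]) (by rwa [ba 10 (by omega)]) (hperm.nodup_iff.2 List.nodup_range)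
      (fun e he => (hmem e he).trans hMb) (by omega)
      (fun e he => by rw [b8' e (hmem e he)]; exact Nat.mod_lt _ hNpos)).mono ?_)
    rintro σ₂ ⟨d0, da, dL, -, dc⟩
    have d7 := da 7 (by omega) (by omega) (by omega) (by omega)
    have d00 := da 0 (by omega) (by omega) (by omega) (by omega)
    refine (wp_divideQuotients (N := N) (by rw [d00, ba 0 (by omega), a0, hN])
      (by rw [d0, b0, h0]) hMb).mono ?_
    rintro σ₃ ⟨e0, ea, e7, ez, enz, ec⟩
    have e7' : ∀ e < M, σ₃.arr 7 e = σ.arr 4 e / N ^ (p + 1) := fun e he => by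
      rw [e7 e he, d7, ba 7 (by omega), hq' e he, Nat.div_div_eq_div_mul, pow_succ]
    refine ⟨k - 1, by omega, p + 1, buckets (σ₁.arr 8) N A, by omega, ?_, ?_, ?_, e7', ez, ?_,
      by rw [e0, d0, b0, h0], fun a h => ?_, ?_⟩
    · refine (buckets_perm fun e he => ?_).trans hperm
      rw [b8' e (hmem e he)]; exact Nat.mod_lt _ hNpos
    · rwa [ea 10 (by omega)]
    · exact buckets_digit_pairwise hmem b8' hs
    · intro hv
      obtain ⟨e, he, hne'⟩ := enz hv
      by_contra! hcon
      rw [e7' e he] at hne'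
      refine hne' (Nat.div_eq_of_lt ((hlab e he).trans_le ?_))
      exact Nat.pow_le_pow_right hNpos (by omega)
    · rw [ea a (by omega), da a (by omega) (by omega) (by omega) (by omega), ba a (by omega),
        ha a h]
    · rw [add_mul, one_mul]
      omega
  · rintro k σ' ⟨p, A, hpk, hperm, hL, hs, hq', hz, hnz, h0, ha, hc⟩ h2
    have hmem : ∀ e ∈ A, e < M := fun e he => List.mem_range.1 (hperm.mem_iff.1 he)
    have hsmall : ∀ e ∈ A, σ.arr 4 e % N ^ p = σ.arr 4 e := by
      intro e he
      have h1 := hq' e (hmem e he)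
      rw [hz h2 e (hmem e he)] at h1
      refine Nat.mod_eq_of_lt ?_
      rcases Nat.div_eq_zero_iff.1 h1.symm with h | h
      · exact absurd h (by positivity)
      · exact h
    refine ⟨A, hperm, hL, hs.imp_of_mem fun {a b} h1 h3 h4 => ?_, by simpa [hM] using h0, ha, ?_⟩
    · rwa [hsmall a h1, hsmall b h3] at h4
    · have : p * (3000 * n) ≤ (c + 1) * (3000 * n) := Nat.mul_le_mul_right _ (by omega)
      simp; omega
  · refine ⟨0, List.range M, by omega, List.Perm.refl _, by simpa using hord, ?_, ?_, ?_, ?_, ?_,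
      ?_, ?_⟩
    · simp only [pow_zero, Nat.mod_one]
      exact List.pairwise_lt_range.imp fun _ => le_rfl
    · simpa using hq
    · simp [St.setVar_var]
    · simp
    · simpa [St.setVar_var] using hM
    · simp
    · simp

theorem wp_sortSources {σ : St} {A : List ℕ} (hN : σ.arr 0 1 = N) (hNb : N < m.blk)
    (hM : σ.var 0 = M) (hMb : M < m.blk) (hA : A.Perm (List.range M)) (hL : Lst (σ.arr 10) 0 A)
    (hsrc : ∀ e < M, σ.arr 5 e < N) :
    WP m sortSources σ fun σ' => σ'.var 0 = σ.var 0 ∧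
      (∀ a, a < 8 ∨ 12 < a → σ'.arr a = σ.arr a) ∧
      Lst (σ'.arr 10) 0 (buckets (σ.arr 5) N A) ∧
      (∀ k ≤ N, σ'.arr 12 k = (buckets (σ.arr 5) k A).length) ∧
      σ'.clk ≤ σ.clk + 100 * N + 140 * M + 140 := by
  have hblk := m.le_blk
  have hmem : ∀ e ∈ A, e < M := fun e he => List.mem_range.1 (hA.mem_iff.1 he)
  have hlen : A.length = M := by simpa using hA.length_eq
  refine WP.seq ?_
  refine WP.for_ (count := M) (fun j σ' => σ'.var 0 = σ.var 0 ∧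
    (∀ a, a ≠ 8 → σ'.arr a = σ.arr a) ∧ (∀ e < j, σ'.arr 8 e = σ.arr 5 e) ∧
    σ'.clk ≤ σ.clk + 40 * j + 2) (by omega) ?_ ?_ ?_ ?_
  · simp [St.setVar_var]
  · rintro j hj σ' ⟨h0, -⟩ -
    simp [h0, hM]
  · rintro j hj σ' ⟨h0, ha, he, hc⟩ hx
    refine WP.put (by omega) (by simp) (by simp [hx]; omega) (by simp [hx]; omega) ?_
    simp [St.setVar_var, St.setArr_arr, hx, h0, ha 5]
    refine ⟨fun a h => by simp [h, ha a h], fun e hej => ?_, by omega⟩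
    rcases hej.lt_or_eq with hlt | rfl
    · rw [Function.update_of_ne hlt.ne, he e hlt]
    · rw [Function.update_self]
  · rintro σ' ⟨h0, ha, he, hc⟩
    have hkey : ∀ e ∈ A, σ'.arr 8 e = σ.arr 5 e := fun e h => he e (hmem e h)
    refine (wp_bucketSort (N := N) (A := A) (by simp [ha 0, hN]) hNb (by simp [h0, hM, hlen])
      (by simpa [ha 10] using hL) (hA.nodup_iff.2 List.nodup_range)
      (fun e h => (hmem e h).trans hMb) (by omega)
      (fun e h => by simp [hkey e h, hsrc e (hmem e h)])).mono ?_
    rintro σ'' ⟨g0, ga, gL, goff, gc⟩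
    simp only [St.tick_var, St.tick_arr, St.tick_clk, Expr.cost] at g0 ga gL goff gc
    refine ⟨g0.trans h0, fun a h => ?_, ?_, fun k hk => ?_, by omega⟩
    · rw [ga a (by omega) (by omega) (by omega) (by omega), ha a (by omega)]
    · rwa [buckets_congr hkey] at gL
    · rw [goff k hk, buckets_congr hkey]

end

end WordRAM

/-! ### Writing the output -/

namespace WordRAM

open StringIndex

/-- The nodes, the offsets, the edges in the order of array `10`, and the suffix links are written
to array `1`. -/
def writeOutput : Prog :=
  put 1 (.lit 0) numNodes ;;
  put 1 (.lit 1) (.get 0 (.lit 2)) ;;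
  for_ 1 (numNodes +ₑ .lit 1) (put 1 (.lit 2 +ₑ .var 1) (.get 12 (.var 1))) ;;
  for_ 1 (.var 0) (
    assign 2 (.get 10 (.var 1)) ;;
    put 1 (.lit 3 +ₑ numNodes +ₑ .lit 2 *ₑ .var 1) (.get 4 (.var 2)) ;;
    put 1 (.lit 4 +ₑ numNodes +ₑ .lit 2 *ₑ .var 1) (.get 6 (.var 2))) ;;
  for_ 1 numNodes (
    put 1 (.lit 3 +ₑ numNodes +ₑ .lit 2 *ₑ .var 0 +ₑ .lit 3 *ₑ .var 1) (.get 13 (.var 1)) ;;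
    put 1 (.lit 4 +ₑ numNodes +ₑ .lit 2 *ₑ .var 0 +ₑ .lit 3 *ₑ .var 1) (.get 14 (.var 1)) ;;
    put 1 (.lit 5 +ₑ numNodes +ₑ .lit 2 *ₑ .var 0 +ₑ .lit 3 *ₑ .var 1)
      (.get 2 (.var 1) *ₑ .get 13 (.var 1)))

theorem lst_map_range {f g : ℕ → ℕ} {c n : ℕ} :
    Lst f c ((List.range n).map g) ↔ ∀ k < n, f (c + k) = g k := by
  simp [Lst]

theorem lst_flatMap_range {f : ℕ → ℕ} {g : ℕ → List ℕ} {c d n : ℕ} (hg : ∀ b, (g b).length = d) :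
    Lst f c ((List.range n).flatMap g) ↔ ∀ k < n, Lst f (c + d * k) (g k) := by
  rw [lst_flatMap_const hg]
  simp

theorem wp_writeOutput {m : Mach} {σ : St} {N M root : ℕ} {F : List ℕ} (hN : σ.arr 0 1 = N)
    (hroot : σ.arr 0 2 = root) (hM : σ.var 0 = M) (hF : Lst (σ.arr 10) 0 F) (hFM : F.length = M)
    (hFb : ∀ e ∈ F, e < m.blk) (hb : 3 + N + 2 * M + 3 * N ≤ m.blk)
    (hp : ∀ v < N, σ.arr 2 v * σ.arr 13 v < 16 * m.blk) :
    WP m writeOutput σ fun σ' => σ'.clk ≤ σ.clk + 300 * N + 150 * M + 200 ∧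
      Lst (σ'.arr 1) 0 ([N, root] ++ (List.range (N + 1)).map (σ.arr 12) ++
        F.flatMap (fun e => [σ.arr 4 e, σ.arr 6 e]) ++
        (List.range N).flatMap fun v => [σ.arr 13 v, σ.arr 14 v, σ.arr 2 v * σ.arr 13 v]) := by
  have hblk := m.le_blk
  refine WP.seq (WP.put (by omega) (by simp; omega) (by simp; omega) (by simp; omega) ?_)
  refine WP.seq (WP.put (by omega) (by simp; omega) (by simp; omega)
    (by simp; omega) ?_)
  refine WP.seq (WP.for_ (count := N + 1) (fun j σ' => σ'.var 0 = M ∧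
    (∀ a, a ≠ 1 → σ'.arr a = σ.arr a) ∧ σ'.arr 1 0 = N ∧ σ'.arr 1 1 = root ∧
    (∀ k < j, σ'.arr 1 (2 + k) = σ.arr 12 k) ∧ σ'.clk ≤ σ.clk + 60 * j + 40)
    (by omega) ?_ ?_ ?_ ?_)
  · simp [St.setVar_var, St.setArr_arr, hM, hN, hroot]
    intro a ha; simp [ha]
  · rintro j hj σ' ⟨-, ha, -⟩ -
    simp [ha 0, hN]; omega
  · rintro j hj σ' ⟨h0, ha, h10, h11, hk, hc⟩ hx
    refine WP.put (by omega) (by simp [hx]; omega) (by simp [hx]; omega) (by simp [hx]; omega) ?_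
    simp [St.setVar_var, St.setArr_arr, hx, h0, ha 12]
    refine ⟨fun a h => by simp [h, ha a h], ?_, ?_, fun k hkj => ?_, by omega⟩
    · rwa [Function.update_of_ne (by omega)]
    · rwa [Function.update_of_ne (by omega)]
    · rcases hkj.lt_or_eq with hlt | rfl
      · rw [Function.update_of_ne (by omega), hk k hlt]
      · rw [Function.update_self]
  rintro σ₁ ⟨a0, aa, a10, a11, ak, ac⟩
  refine WP.seq (WP.for_ (count := M) (fun j σ' => σ'.var 0 = M ∧
    (∀ a, a ≠ 1 → σ'.arr a = σ.arr a) ∧ (∀ i < 3 + N, σ'.arr 1 i = σ₁.arr 1 i) ∧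
    (∀ k (h : k < F.length), k < j → σ'.arr 1 (3 + N + 2 * k) = σ.arr 4 F[k] ∧
      σ'.arr 1 (4 + N + 2 * k) = σ.arr 6 F[k]) ∧
    σ'.clk ≤ σ.clk + 60 * N + 120 * j + 120)
    (by omega) ?_ ?_ ?_ ?_)
  · simp [St.setVar_var, a0]
    exact ⟨fun a ha => by rw [aa a ha], by omega⟩
  · rintro j hj σ' ⟨h0, -⟩ -
    simp [h0]
  · rintro j hj σ' ⟨h0, ha, hi, hk, hc⟩ hx
    have hFj : σ.arr 10 j = F[j] := by simpa using hF j (by omega)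
    have hFjb := hFb F[j] (List.getElem_mem _)
    refine WP.seq (WP.assign (by simp [hx]; omega) ?_)
    refine WP.seq (WP.put (by omega) (by simp [hx, St.setVar_var, ha 0, hN]; omega)
      (by simp [hx, St.setVar_var, ha 0, hN]; omega)
      (by simp [hx, St.setVar_var, ha 10, hFj, hFjb]) ?_)
    refine WP.put (by omega) (by simp [hx, St.setVar_var, St.setArr_arr, ha 0, hN]; omega)
      (by simp [hx, St.setVar_var, St.setArr_arr, ha 0, hN]; omega)
      (by simp [hx, St.setVar_var, ha 10, hFj, hFjb]) ?_
    simp [St.setVar_var, St.setArr_arr, hx, h0, ha 0, ha 10, ha 4, ha 6, hN, hFj]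
    refine ⟨fun a h => by simp [h, ha a h], fun i hi' => ?_, fun k hkF hkj => ?_, by omega⟩
    · rw [Function.update_of_ne (by omega), Function.update_of_ne (by omega), hi i hi']
    · rcases hkj.lt_or_eq with hlt | rfl
      · rw [Function.update_of_ne (by omega), Function.update_of_ne (by omega),
          Function.update_of_ne (by omega), Function.update_of_ne (by omega)]
        exact hk k hkF hlt
      · rw [Function.update_self, Function.update_of_ne (by omega), Function.update_self]
        exact ⟨rfl, rfl⟩
  rintro σ₂ ⟨b0, ba, bi, bk, bc⟩
  refine WP.for_ (count := N) (fun j σ' => σ'.var 0 = M ∧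
    (∀ a, a ≠ 1 → σ'.arr a = σ.arr a) ∧ (∀ i < 3 + N + 2 * M, σ'.arr 1 i = σ₂.arr 1 i) ∧
    (∀ k < j, σ'.arr 1 (3 + N + 2 * M + 3 * k) = σ.arr 13 k ∧
      σ'.arr 1 (4 + N + 2 * M + 3 * k) = σ.arr 14 k ∧
      σ'.arr 1 (5 + N + 2 * M + 3 * k) = σ.arr 2 k * σ.arr 13 k) ∧
    σ'.clk ≤ σ.clk + 60 * N + 120 * M + 200 * j + 140)
    (by omega) ?_ ?_ ?_ ?_
  · simp [St.setVar_var, b0]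
    exact ⟨fun a ha => by rw [ba a ha], by omega⟩
  · rintro j hj σ' ⟨-, ha, -⟩ -
    simp [ha 0, hN]; omega
  · rintro j hj σ' ⟨h0, ha, hi, hk, hc⟩ hx
    have hpj := hp j hj
    refine WP.seq (WP.put (by omega) (by simp [hx, ha 0, hN, h0]; omega)
      (by simp [hx, ha 0, hN, h0]; omega) (by simp [hx]; omega) ?_)
    refine WP.seq (WP.put (by omega) (by simp [hx, St.setArr_arr, ha 0, hN, h0]; omega)
      (by simp [hx, St.setArr_arr, ha 0, hN, h0]; omega) (by simp [hx]; omega) ?_)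
    refine WP.put (by omega) (by simp [hx, St.setArr_arr, ha 0, hN, h0]; omega)
      (by simp [hx, St.setArr_arr, ha 0, hN, h0]; omega)
      (by simp [hx, St.setArr_arr, ha 2, ha 13, hpj]; omega) ?_
    simp [St.setVar_var, St.setArr_arr, hx, h0, ha 0, ha 2, ha 13, ha 14, hN]
    refine ⟨fun a h => by simp [h, ha a h], fun i hi' => ?_, fun k hkj => ?_, by omega⟩
    · rw [Function.update_of_ne (by omega), Function.update_of_ne (by omega),
        Function.update_of_ne (by omega), hi i hi']
    · rcases hkj.lt_or_eq with hlt | rfl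
      · simp only [
          Function.update_of_ne (show 3 + N + 2 * M + 3 * k ≠ 5 + N + 2 * M + 3 * j by omega),
          Function.update_of_ne (show 3 + N + 2 * M + 3 * k ≠ 4 + N + 2 * M + 3 * j by omega),
          Function.update_of_ne (show 3 + N + 2 * M + 3 * k ≠ 3 + N + 2 * M + 3 * j by omega),
          Function.update_of_ne (show 4 + N + 2 * M + 3 * k ≠ 5 + N + 2 * M + 3 * j by omega),
          Function.update_of_ne (show 4 + N + 2 * M + 3 * k ≠ 4 + N + 2 * M + 3 * j by omega),
          Function.update_of_ne (show 4 + N + 2 * M + 3 * k ≠ 3 + N + 2 * M + 3 * j by omega),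
          Function.update_of_ne (show 5 + N + 2 * M + 3 * k ≠ 5 + N + 2 * M + 3 * j by omega),
          Function.update_of_ne (show 5 + N + 2 * M + 3 * k ≠ 4 + N + 2 * M + 3 * j by omega),
          Function.update_of_ne (show 5 + N + 2 * M + 3 * k ≠ 3 + N + 2 * M + 3 * j by omega)]
        exact hk k hlt
      · simp only [
          Function.update_of_ne (show 3 + N + 2 * M + 3 * k ≠ 5 + N + 2 * M + 3 * k by omega),
          Function.update_of_ne (show 3 + N + 2 * M + 3 * k ≠ 4 + N + 2 * M + 3 * k by omega),
          Function.update_of_ne (show 4 + N + 2 * M + 3 * k ≠ 5 + N + 2 * M + 3 * k by omega),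
          Function.update_self, and_self]
  rintro σ₃ ⟨c0, ca, ci, ck, cc⟩
  refine ⟨by simp; omega, ?_⟩
  have hlen : (F.flatMap fun e => [σ.arr 4 e, σ.arr 6 e]).length = 2 * M := by
    rw [flatMap_length_const (d := 2) (fun _ => rfl), hFM]
  rw [lst_append, lst_append, lst_append, lst_map_range,
    lst_flatMap_const (g := fun e => [σ.arr 4 e, σ.arr 6 e]) (d := 2) (fun _ => rfl),
    lst_flatMap_range (d := 3) (fun _ => rfl)]
  simp only [lst_cons, lst_nil, and_true, List.length_append, List.length_cons, List.length_nil,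
    List.length_map, List.length_range, hlen, St.tick_arr, zero_add]
  refine ⟨⟨⟨⟨?_, ?_⟩, fun k hk => ?_⟩, fun k hk => ?_⟩, fun k hk => ?_⟩
  · rw [ci 0 (by omega), bi 0 (by omega)]; exact a10
  · rw [ci 1 (by omega), bi 1 (by omega)]; exact a11
  · rw [ci _ (by omega), bi _ (by omega)]; exact ak k hk
  · have := bk k hk (by omega)
    rw [← ci _ (by omega), ← ci _ (by omega)] at this
    exact ⟨(congrArg _ (by omega)).trans this.1, (congrArg _ (by omega)).trans this.2⟩
  · have := ck k hk
    exact ⟨(congrArg _ (by omega)).trans this.1, (congrArg _ (by omega)).trans this.2.1,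
      (congrArg _ (by omega)).trans this.2.2⟩

/-! ### The constructed DAWG -/

/-- The DAWG with the nodes `0, …, N - 1`, the edges with the numbers in `A`, in the order of `A` at
each node, and the suffix links of the marked nodes. -/
def dawgOf (N root : ℕ) (src lab dst mark first par : ℕ → ℕ) (A : List ℕ) : DawgData where
  size := N
  source := root
  adj v := (A.filter fun e => src e = v).map fun e => (lab e, dst e)
  link v := if mark v = 0 then none else some (first v, par v)

theorem offset_dawgOf {N root : ℕ} {src lab dst mark first par : ℕ → ℕ} {A : List ℕ} (k : ℕ) :
    (dawgOf N root src lab dst mark first par A).offset k = (buckets src k A).length := by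
  induction k with
  | zero => rfl
  | succ k ih =>
    rw [buckets_succ, List.length_append, ← ih]
    simp [DawgData.offset, Finset.sum_range_succ, dawgOf]

theorem words_dawgOf {N root : ℕ} {src lab dst mark first par off : ℕ → ℕ} {A : List ℕ}
    (hoff : ∀ k ≤ N, off k = (buckets src k A).length)
    (hmark : ∀ v < N, mark v = 0 ∧ first v = 0 ∨ mark v = 1) :
    (dawgOf N root src lab dst mark first par A).words =
      [N, root] ++ (List.range (N + 1)).map off ++
        (buckets src N A).flatMap (fun e => [lab e, dst e]) ++
        (List.range N).flatMap fun v => [mark v, first v, par v * mark v] := by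
  unfold DawgData.words
  have h1 : (List.range (N + 1)).map (dawgOf N root src lab dst mark first par A).offset =
      (List.range (N + 1)).map off := by
    refine List.map_congr_left fun k hk => ?_
    rw [offset_dawgOf, hoff k (by simpa [Nat.lt_succ_iff] using hk)]
  have h2 : (List.range N).flatMap (fun v =>
      ((dawgOf N root src lab dst mark first par A).adj v).flatMap fun e => [e.1, e.2]) =
      (buckets src N A).flatMap (fun e => [lab e, dst e]) := by
    rw [buckets, List.flatMap_assoc]
    simp [dawgOf, List.flatMap_map]
  have h3 : (List.range N).flatMap (fun v =>
      match (dawgOf N root src lab dst mark first par A).link v with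
      | none => [0, 0, 0]
      | some e => [1, e.1, e.2]) =
      (List.range N).flatMap fun v => [mark v, first v, par v * mark v] := by
    refine List.flatMap_congr fun v hv => ?_
    rcases hmark v (List.mem_range.1 hv) with ⟨hm, hf⟩ | hm <;> simp [dawgOf, *]
  rw [← h1, ← h2, ← h3]
  rfl

end WordRAM

namespace StringIndex.TreeData.Represents

open WordRAM

variable {T : TreeData} {y : List ℕ} {node : ℕ → List ℕ} (h : T.Represents y node)
  {W : TreeLink → List ℕ}
  (hW : ∀ l ∈ T.links, (W l).Nodup ∧ ∀ X, X ∈ W l ↔ X < T.size ∧ l.label :: node X ∈ Substr y ∧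
    Occ y (l.label :: node X) = Occ y (node l.src))
include h hW

theorem mem_linkRecords {V b v : ℕ} : (V, b, v) ∈ T.links.flatMap (linkRecords W) ↔
    V < T.size ∧ v < T.size ∧ b :: node V ∈ Substr y ∧ Occ y (b :: node V) = Occ y (node v) := by
  simp only [linkRecords, List.mem_flatMap, List.mem_map, Prod.mk.injEq]
  constructor
  · rintro ⟨l, hl, X, hX, rfl, rfl, rfl⟩
    obtain ⟨h1, h2, h3⟩ := ((hW l hl).2 X).1 hX
    exact ⟨h1, (h.link_spec hl).1, h2, h3⟩
  · rintro ⟨h1, h2, h3, h4⟩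
    obtain ⟨t, ht⟩ := node_prefix (h.node_mem h2) h3 h4
    obtain ⟨l, hl, rfl, rfl, -⟩ := h.exists_link h2 (ht.symm.trans (List.cons_append ..))
    exact ⟨l, hl, V, ((hW l hl).2 V).2 ⟨h1, h3, h4⟩, rfl, rfl, rfl⟩

/-- The node `V` and the label `b` determine the record, since the target is the node with the
beginning positions of `bV`. -/
theorem linkRecords_nodup :
    ((T.links.flatMap (linkRecords W)).map fun r => (r.1, r.2.1)).Nodup := by
  rw [List.map_flatMap, List.nodup_flatMap]
  constructor
  · intro l hl
    simp only [linkRecords, List.map_map]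
    exact (hW l hl).1.map fun a b hab => by simpa using hab
  · refine (List.Nodup.of_map _ h.links.1).imp_of_mem fun {l l'} hl hl' hne => ?_
    intro e he he'
    simp only [linkRecords, List.map_map, List.mem_map] at he he'
    obtain ⟨X, hX, rfl⟩ := he
    obtain ⟨X', hX', heq⟩ := he'
    simp only [Function.comp, Prod.mk.injEq] at heq
    obtain ⟨rfl, hlab⟩ := heq
    have h1 := ((hW l hl).2 _).1 hX
    have h2 := ((hW l' hl').2 _).1 hX'
    rw [hlab] at h2
    exact hne (h.link_src_inj hl hl' (h.node_inj (h.link_spec hl).1 (h.link_spec hl').1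
      (node_eq (h.node_mem (h.link_spec hl).1) (h.node_mem (h.link_spec hl').1)
        (h1.2.2.symm.trans h2.2.2))))

theorem linkRecords_length_le :
    (T.links.flatMap (linkRecords W)).length ≤ 3 * y.length + 3 := by
  have := weiner_links_length_le (y := y)
    (l := ((T.links.flatMap (linkRecords W)).map fun r => (r.1, r.2.1)).map
      fun e => (node e.1, e.2)) ?_ ?_
  · simpa using this
  · refine (h.linkRecords_nodup hW).map_on ?_
    rintro ⟨V, b⟩ he ⟨V', b'⟩ he' heq
    obtain ⟨⟨V, b, v⟩, hm, rfl, rfl⟩ :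
        ∃ r ∈ T.links.flatMap (linkRecords W), r.1 = V ∧ r.2.1 = b := by
      simpa using he
    obtain ⟨⟨V', b', v'⟩, hm', rfl, rfl⟩ :
        ∃ r ∈ T.links.flatMap (linkRecords W), r.1 = V' ∧ r.2.1 = b' := by
      simpa using he'
    simp only [Prod.mk.injEq] at heq ⊢
    exact ⟨h.node_inj ((h.mem_linkRecords hW).1 hm).1 ((h.mem_linkRecords hW).1 hm').1 heq.1, heq.2⟩
  · rintro e he
    simp only [List.map_map, List.mem_map, Function.comp] at he
    obtain ⟨⟨V, b, v⟩, hm, rfl⟩ := he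
    have := (h.mem_linkRecords hW).1 hm
    exact ⟨h.node_mem this.1, this.2.2.1⟩

/-- The constructed DAWG is the edge-sorted DAWG of the reversed string. -/
theorem represents_dawgOf {arr : ℕ → ℕ → ℕ} (ht : TreeRead arr T y) {src lab dst : ℕ → ℕ}
    {A : List ℕ}
    (hR : ∀ i (hi : i < (T.links.flatMap (linkRecords W)).length),
      src i = (T.links.flatMap (linkRecords W))[i].1 ∧
      lab i = (T.links.flatMap (linkRecords W))[i].2.1 ∧
      dst i = (T.links.flatMap (linkRecords W))[i].2.2)
    (hA : A.Perm (List.range (T.links.flatMap (linkRecords W)).length))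
    (hs : A.Pairwise fun a b => lab a ≤ lab b) :
    (dawgOf T.size T.root src lab dst (arr 13) (arr 14) (arr 2) A).Represents y.reverse
      (fun v => endClass y.reverse (node v).reverse) := by
  set R := T.links.flatMap (linkRecords W) with hRdef
  have hmem : ∀ e ∈ A, e < R.length := fun e he => List.mem_range.1 (hA.mem_iff.1 he)
  have hadj : ∀ v a u,
      (a, u) ∈ (dawgOf T.size T.root src lab dst (arr 13) (arr 14) (arr 2) A).adj v ↔
      (v, a, u) ∈ R := by
    intro v a u
    simp only [dawgOf, List.mem_map, List.mem_filter, decide_eq_true_eq, Prod.mk.injEq]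
    constructor
    · rintro ⟨e, ⟨he, rfl⟩, rfl, rfl⟩
      obtain ⟨h1, h2, h3⟩ := hR e (hmem e he)
      rw [h1, h2, h3]
      exact List.getElem_mem _
    · intro hin
      obtain ⟨i, hi, heq⟩ := List.getElem_of_mem hin
      obtain ⟨h1, h2, h3⟩ := hR i hi
      rw [heq] at h1 h2 h3
      exact ⟨i, ⟨hA.mem_iff.2 (List.mem_range.2 hi), h1⟩, h2, h3⟩
  have hlink : ∀ v < T.size, ∀ e,
      (dawgOf T.size T.root src lab dst (arr 13) (arr 14) (arr 2) A).link v = some e ↔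
        ∃ ed ∈ T.edges, ed.dst = v ∧ ed.src = e.2 ∧ y[ed.i - 1]? = some e.1 := by
    intro v hv e
    by_cases hr : v = T.root
    · subst hr
      simp only [dawgOf, ht.mark_root, if_true, reduceCtorEq, false_iff]
      rintro ⟨ed, hed, hd, -⟩
      exact h.edge_dst_ne_root hed hd
    · obtain ⟨ed, hed, rfl⟩ := h.exists_edge hv hr
      simp only [dawgOf, ht.mark ed hed, one_ne_zero, if_false, Option.some.injEq]
      constructor
      · rintro rfl
        exact ⟨ed, hed, rfl, (ht.par ed hed).symm, ht.first ed hed⟩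
      · rintro ⟨ed', hed', hd, h1, h2⟩
        obtain rfl := h.edge_dst_inj hed' hed hd
        rw [ht.first _ hed, Option.some.injEq] at h2
        rw [h2, ht.par _ hed, h1]
  refine ⟨h.dawg_bijOn, h.root_lt, by simp [dawgOf, h.root_eq], ?_, ?_, ?_, ?_, ?_⟩
  · rintro v hv ⟨a, u⟩ he
    exact ((h.mem_linkRecords hW).1 ((hadj v a u).1 he)).2.1
  · intro v hv u hu a
    rw [hadj, h.mem_linkRecords hW, mem_dawgEdges]
    exact ⟨fun h' => h'.2.2, fun h' => ⟨hv, hu, h'⟩⟩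
  · intro v hv
    simp only [dawgOf, List.pairwise_map]
    have hnd : A.Pairwise (· ≠ ·) := hA.nodup_iff.2 List.nodup_range
    refine ((hs.and hnd).filter _).imp_of_mem fun {a b} ha hb hab => ?_
    rw [List.mem_filter, decide_eq_true_eq] at ha hb
    refine lt_of_le_of_ne hab.1 fun heq => hab.2 ?_
    -- the source and the label determine the record
    have hla := hmem a ha.1
    have hlb := hmem b hb.1
    have := (h.linkRecords_nodup hW).getElem_inj_iff (i := a) (j := b)
      (hi := by rwa [List.length_map]) (hj := by rwa [List.length_map])
    rw [← this]
    simp only [List.getElem_map]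
    have ra := hR a hla
    have rb := hR b hlb
    rw [Prod.mk.injEq]
    exact ⟨by rw [← ra.1, ← rb.1, ha.2, hb.2], by rw [← ra.2.1, ← rb.2.1, heq]⟩
  · intro v hv e he
    obtain ⟨ed, hed, -, h1, -⟩ := (hlink v hv e).1 he
    rw [← h1]
    exact (h.edge_spec hed).1
  · intro v hv u hu a
    rw [hlink v hv, h.mem_dawgLinks hu hv]

end StringIndex.TreeData.Represents

/-! ### The whole program -/

namespace WordRAM

open StringIndex

/-- Register `0` is set to `64` times the length of the string, the length of the arrays. This is
also the address of array `1`, which will hold the output. -/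
def setup : Prog := .const 1 0 ;; .load 1 1 ;; .const 3 64 ;; .bin .mul 0 1 3

theorem exec_setup {w S n : ℕ} {s : State} (hs : s.Fits w) (h0 : s.mem 0 = n) (hS : 0 < S)
    (h64 : 64 < 2 ^ w) (hn : 64 * n < 2 ^ w) :
    ∃ s', Exec w S setup s 4 s' ∧ s'.Fits w ∧ s'.reg 0 = 64 * n ∧ s'.mem = s.mem := by
  refine ⟨_, (Exec.const 1 0 s).seq ((Exec.load 1 1 _ (by simpa using hS)).seq
    ((Exec.const 3 64 _).seq (Exec.bin .mul 0 1 3 _))), ?_, ?_, rfl⟩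
  · exact (((hs.update_reg _ (Nat.mod_lt _ (by positivity))).update_reg _ (hs.2 _)).update_reg _
      (Nat.mod_lt _ (by positivity))).update_reg _ (BinOp.eval_lt _ _ _ _)
  · have hprod : n * 64 % 2 ^ w = 64 * n := by rw [mul_comm]; exact Nat.mod_eq_of_lt hn
    simp [BinOp.eval, h0, Nat.mod_eq_of_lt h64, hprod]

/-- The program that turns the suffix tree of a string into the DAWG of the reversed string. -/
def buildDawg : Prog :=
  (initNodes ;; readEdges ;; readLinks) ;; makeRecords ;; sortLabels ;; sortSources ;; writeOutput

theorem Setting.wp_buildDawg {m : Mach} {T : TreeData} {y : List ℕ} {node : ℕ → List ℕ} {c : ℕ}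
    (h : Setting m T y node) (hy : ∀ a ∈ y, a ≤ y.length ^ c) {σ : St}
    (hin : Input (σ.arr 0) T y) :
    WP m buildDawg σ fun σ' => σ'.clk ≤ σ.clk + (c + 1) * (3000 * y.length) + 6500 * y.length ∧
      ∃ (D : DawgData) (dawgNode : ℕ → Set (List ℕ)), D.Represents y.reverse dawgNode ∧
        D.words.length ≤ m.blk ∧ Lst (σ'.arr 1) 0 D.words := by
  obtain ⟨b1, b2, b3, b4, b5⟩ := h.bounds
  have hNpos : 0 < T.size := (Nat.zero_le _).trans_lt h.rep.root_lt
  refine WP.seq ((h.wp_readTree hin).mono ?_)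
  rintro σ₁ ⟨ht, hc₁⟩
  have hex : ∀ l, ∃ ws, l ∈ T.links → Walk (σ₁.arr 2) (σ₁.arr 3 (σ₁.arr 2 l.src)) l.dst ws ∧
      ws.Nodup ∧ ∀ X, X ∈ ws ↔ X < T.size ∧ l.label :: node X ∈ Substr y ∧
        Occ y (l.label :: node X) = Occ y (node l.src) := fun l => by
    by_cases hl : l ∈ T.links
    · obtain ⟨ws, hws⟩ := h.rep.exists_walk ht.par ht.par_root ht.link ht.link_root hl
      exact ⟨ws, fun _ => hws⟩
    · exact ⟨[], fun hl' => absurd hl' hl⟩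
  choose W hW using hex
  have hW' := fun l hl => (hW l hl).2
  have hmemR := @TreeData.Represents.mem_linkRecords _ _ _ h.rep _ hW'
  have hle := h.rep.linkRecords_length_le hW'
  refine WP.seq ((h.wp_makeRecords ht (fun l hl => (hW l hl).1)
    (fun l hl X hX => (((hW' l hl).2 X).1 hX).1) (by omega)).mono ?_)
  rintro σ₂ ⟨hR, hv, ha, hc₂⟩
  have hD := fun A src lab dst => h.rep.represents_dawgOf hW' ht (A := A) (src := src)
    (lab := lab) (dst := dst)
  set R := T.links.flatMap (linkRecords W)
  have g : ∀ a, a < 4 ∨ 10 < a → σ₂.arr a = σ₁.arr a := fun a h =>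
    ha a (by omega) (by omega) (by omega) (by omega) (by omega)
  have hsize : σ₂.arr 0 1 = T.size := by rw [g 0 (by omega)]; exact ht.input.size
  have hRmem : ∀ e (he : e < R.length), R[e].1 < T.size ∧ R[e].2.1 ∈ y := by
    intro e he
    obtain ⟨h1, -, ⟨u, v, huv⟩, -⟩ :=
      hmemR.1 (List.getElem_mem he : (R[e].1, R[e].2.1, R[e].2.2) ∈ R)
    exact ⟨h1, by rw [huv]; simp⟩
  refine WP.seq ((wp_sortLabels (N := T.size) (M := R.length) (c := c) (n := y.length)
    hsize (by omega) hv (by omega) (by omega) (by omega) b4 hNpos ?_ ?_ ?_).mono ?_)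
  · intro e he
    rw [(hR e he).2.1]
    calc R[e].2.1 ≤ y.length ^ c := hy _ (hRmem e he).2
      _ ≤ T.size ^ c := Nat.pow_le_pow_left h.rep.length_lt_size.le c
      _ < T.size ^ (c + 1) :=
        Nat.pow_lt_pow_right (by have := h.rep.length_lt_size; omega) (Nat.lt_succ_self c)
  · intro e he
    rw [(hR e he).2.1, (hR e he).2.2.2.1]
  · intro i hi
    rw [List.length_range] at hi
    rw [List.getElem_range, zero_add, (hR i hi).2.2.2.2]
  rintro σ₃ ⟨A, hperm, hL, hs, hv₃, ha₃, hc₃⟩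
  have hlenA : A.length = R.length := by simpa using hperm.length_eq
  have hsrc : ∀ e < R.length, σ₃.arr 5 e < T.size := fun e he => by
    rw [ha₃ 5 (by omega), (hR e he).1]
    exact (hRmem e he).1
  refine WP.seq ((wp_sortSources (N := T.size) (M := R.length) (by rw [ha₃ 0 (by omega), hsize])
    (by omega) (by rw [hv₃, hv]) (by omega) hperm hL hsrc).mono ?_)
  rintro σ₄ ⟨hv₄, ha₄, hL₄, hoff, hc₄⟩
  have hA : ∀ a, a < 4 ∨ 12 < a → σ₄.arr a = σ₁.arr a := fun a h => by
    rw [ha₄ a (by omega), ha₃ a (by omega), g a (by omega)]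
  have hpermF : (buckets (σ₃.arr 5) T.size A).Perm A :=
    buckets_perm fun e he => hsrc e (List.mem_range.1 (hperm.mem_iff.1 he))
  have hmark : ∀ v < T.size, σ₄.arr 13 v = 0 ∧ σ₄.arr 14 v = 0 ∨ σ₄.arr 13 v = 1 := by
    intro v hv
    rw [hA 13 (by omega), hA 14 (by omega)]
    by_cases hr : v = T.root
    · exact Or.inl ⟨hr ▸ ht.mark_root, hr ▸ ht.first_root⟩
    · obtain ⟨e, he, rfl⟩ := h.rep.exists_edge hv hr
      exact Or.inr (ht.mark e he)
  have hpar : ∀ v < T.size, σ₄.arr 2 v ≤ T.size := by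
    intro v hv
    rw [hA 2 (by omega)]
    by_cases hr : v = T.root
    · exact (hr ▸ ht.par_root).le
    · obtain ⟨e, he, rfl⟩ := h.rep.exists_edge hv hr
      rw [ht.par e he]
      exact (h.rep.edge_spec he).1.le
  refine (wp_writeOutput (N := T.size) (M := R.length) (root := T.root)
    (F := buckets (σ₃.arr 5) T.size A)
    (by rw [hA 0 (by omega)]; exact ht.input.size) (by rw [hA 0 (by omega)]; exact ht.input.root)
    (by rw [hv₄, hv₃, hv]) hL₄ (hpermF.length_eq.trans hlenA) ?_ (by omega) ?_).mono ?_
  · intro e he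
    have := List.mem_range.1 (hperm.mem_iff.1 (hpermF.mem_iff.1 he))
    omega
  · intro v hv
    have h1 := hpar v hv
    rcases hmark v hv with ⟨hm, -⟩ | hm <;> rw [hm] <;> omega
  rintro σ₅ ⟨hc₅, hL₅⟩
  refine ⟨by omega, dawgOf T.size T.root (σ₃.arr 5) (σ₄.arr 4) (σ₄.arr 6) (σ₄.arr 13) (σ₄.arr 14)
    (σ₄.arr 2) A, fun v => endClass y.reverse (node v).reverse, ?_, ?_,
    by rwa [words_dawgOf hoff hmark]⟩
  · have h4 : σ₄.arr 4 = σ₂.arr 4 := by rw [ha₄ 4 (by omega), ha₃ 4 (by omega)]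
    have h5 : σ₃.arr 5 = σ₂.arr 5 := ha₃ 5 (by omega)
    have h6 : σ₄.arr 6 = σ₂.arr 6 := by rw [ha₄ 6 (by omega), ha₃ 6 (by omega)]
    rw [hA 2 (by omega), hA 13 (by omega), hA 14 (by omega), h4, h5, h6]
    exact hD A _ _ _ (fun i hi => ⟨(hR i hi).1, (hR i hi).2.1, (hR i hi).2.2.1⟩) hperm hs
  · rw [words_dawgOf hoff hmark]
    simp only [List.length_append, List.length_cons, List.length_nil, List.length_map,
      List.length_range]
    rw [flatMap_length_const (d := 2) (fun _ => rfl), flatMap_length_const (d := 3) (fun _ => rfl),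
      hpermF.length_eq, hlenA, List.length_range]
    omega

end WordRAM

/-- One word-RAM program turns the suffix tree of any string `y` of length `n` over `[1, n ^ c]`
that ends in a unique character, given with its suffix links, into the edge-sorted DAWG of the
reversed string with suffix links. It takes at most `C * n` steps and `C * n` words of memory, where
`C` depends only on `c`, on words just long enough for the characters and the addresses. Register
`0` finally holds the address of the output; memory cells outside of the input and registers are
initially arbitrary. -/
theorem mainTheorem6 :
    ∃ P : WordRAM.Prog, ∀ c : ℕ, ∃ C : ℕ,
      ∀ (y : List ℕ),
        (∀ a ∈ y, 1 ≤ a ∧ a ≤ y.length ^ c) →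
        (∃ (u : List ℕ) (d : ℕ), y = u ++ [d] ∧ d ∉ u) →
      ∀ (T : StringIndex.TreeData) (treeNode : ℕ → List ℕ), T.Represents y treeNode →
      ∀ (w : ℕ), y.length ^ c < 2 ^ w → C * y.length ≤ 2 ^ w →
      ∀ s : WordRAM.State, s.Fits w → s.Holds 0 (T.words y) →
        ∃ (t : ℕ) (s' : WordRAM.State),
          WordRAM.Exec w (C * y.length) P s t s' ∧ t ≤ C * y.length ∧
          ∃ (D : StringIndex.DawgData) (dawgNode : ℕ → Set (List ℕ)),
            D.Represents y.reverse dawgNode ∧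
            s'.reg 0 + D.words.length ≤ C * y.length ∧
            s'.Holds (s'.reg 0) D.words := by
  refine ⟨.seq WordRAM.setup WordRAM.buildDawg, fun c => ⟨10000 * (c + 2), ?_⟩⟩
  intro y hy hlast T node hT w hw hC s hs hin
  have hn : 1 ≤ y.length := by
    obtain ⟨u, d, rfl, -⟩ := hlast
    simp
  have hmul : 10000 * (c + 2) * y.length = (c + 1) * (10000 * y.length) + 10000 * y.length := by
    ring
  have hmul' : (c + 1) * (3000 * y.length) ≤ (c + 1) * (10000 * y.length) :=
    Nat.mul_le_mul_left _ (by omega)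
  let m : WordRAM.Mach := ⟨w, 10000 * (c + 2) * y.length, 64 * y.length, by omega, by omega, hC⟩
  have hn0 : s.mem 0 = y.length := hin 0 (by simp [StringIndex.TreeData.words])
  obtain ⟨s₀, hsetup, hfits, hreg₀, hmem⟩ := WordRAM.exec_setup (w := w)
    (S := 10000 * (c + 2) * y.length) hs hn0 (by omega) (by omega) (by omega)
  -- after the setup, the memory is read as a sequence of arrays of length `64 * y.length`
  let σ : WordRAM.St :=
    ⟨0, fun x => s₀.reg (2 * x + 2), fun a i => s₀.mem (a * (64 * y.length) + i)⟩
  have hrel : WordRAM.Rel m σ s₀ := ⟨hfits, hreg₀, fun _ => rfl, fun _ _ _ _ => rfl⟩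
  have hset : WordRAM.Setting m T y node := ⟨hT, hn, rfl⟩
  have hinput : WordRAM.Input (σ.arr 0) T y := WordRAM.input_of_lst fun i hi => by
    simpa [σ, hmem] using hin i hi
  obtain ⟨t, s', σ', hexec, ht, hrel', hclk, D, dawgNode, hD, hlen, hL⟩ :=
    hset.wp_buildDawg (fun a ha => (hy a ha).2) hinput s₀ hrel
  have hclk0 : σ.clk = 0 := rfl
  have hblk : m.blk = 64 * y.length := rfl
  have hreg : s'.reg 0 = 64 * y.length := hrel'.blk
  refine ⟨4 + t, s', hsetup.seq hexec, by omega, D, dawgNode, hD, by omega, fun i hi => ?_⟩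
  have h1 := hrel'.arrs 1 (by omega) i (by omega)
  have h2 := hL i hi
  rw [zero_add] at h2
  rw [← h2, ← h1, one_mul, hreg, hblk]
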